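/- Let $K$ be a field of characteristic $0$, let $d$ be an odd integer, and let $\mathcal{LT}=\bigoplus_n \mathcal{LT}(n)$ be the free nonsymmetric operad, in $\mathbb{Z}$-graded $K$-vector spaces with Koszul signs, generated by one ternary operation $t$ of homological degree $d$. The space $\mathcal{LT}(n)$ has as basis the set $\mathcal{T}(n)$ of ternary trees with $n$ leaves (rooted plane trees in which every node has $0$ or $3$ children). Write $\ell(p)$ for the number of leaves (arity) and $w(p)$ for the number of internal nodes of a tree $p$. The partial composition $p\circ_i q$ of trees is, up to a Koszul sign, the tree obtained by identifying leaf $i$ of $p$ with the root of $q$: each tree is the composite of its nodes read in planar preorder, and $q$ changes place with the internal nodes of $p$ that come after leaf $i$ in this order. Composition is extended bilinearly. For trees $p,q\in\mathcal{T}(n)$, compare in path-lex order: $p\prec q$ if the sequence of root-to-leaf distances of $p$, leaves taken from left to right, is lexicographically smaller than that of $q$. For a nonzero $f\in\mathcal{LT}(n)$ let $\ell m(f)$ be its greatest monomial and $\ell c(f)$ the coefficient of $\ell m(f)$. A tree $p$ divides a tree $q$ ($p\mid q$) if $q=\cdots p\cdots$ is obtained from $p$, up to sign, by a sequence of partial compositions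 with other trees; an occurrence of $p$ in $q$ determines the set of internal nodes of $q$ belonging to that copy of $p$. For $f\in \mathcal{LT}(\ell(p))$, let $M(q,p,f)$ denote the result of replacing this copy of $p$ by $f$, with the overall sign chosen so that $M(q,p,p)=q$. If $\ell m(g)\mid \ell m(f)$, a reduction of $f$ by $g$ is $f-\frac{\ell c(f)}{\ell c(g)}M(\ell m(f),\ell m(g),g)$, and $f$ reduces to $0$ by $g$ if $0$ is reached from $f$ by finitely many reductions. A small common multiple (SCM) of $q$ and $r$ is a tree $p$ with given occurrences of $q$ and $r$ in it, such that every internal node of $p$ belongs to one of the two copies and $\ell(p)<\ell(q)+\ell(r)$. For monic $g,h$ with an SCM $p$ of $\ell m(g),\ell m(h)$, the S-polynomial is $M(p,\ell m(g),g)-M(p,\ell m(h),h)$. The ideal $\langle G\rangle$ is the smallest homogeneous subspace of $\mathcal{LT}$ that contains $G$ and is closed under partial composition, on either side, with arbitrary elements. A finite set $G$ of nonzero homogeneous elements is a Gröbner basis for $I=\langle G\rangle$ if for every nonzero homogeneous $f\in I$ there is $g\in G$ with $\ell m(g)\mid\ell m(f)$. (Homogeneous means homogeneous with respect to arity.) Let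 $$\alpha = t\circ_1 t+t\circ_2 t+t\circ_3 t .$$ Then the following hold. 1. For all trees $p,q,r$ and all $1\le i\le \ell(p)$, $$(p\circ_i q)\circ_j r=\begin{cases} p\circ_i(q\circ_{j-i+1}r), & i\le j\le i+\ell(q)-1,\\ (-1)^{w(q)w(r)}\,(p\circ_{j-\ell(q)+1}r)\circ_i q, & i+\ell(q)\le j\le \ell(p)+\ell(q)-1,\\ (-1)^{w(q)w(r)}\,(p\circ_j r)\circ_{i+\ell(r)-1}q, & 1\le j\le i-1.\end{cases}$$ 2. $\{\alpha\}$ is a Gröbner basis for the ideal $\langle\alpha\rangle$ for the path-lex order, and $\alpha$ is monic with $\ell m(\alpha)=t\circ_1 t$. 3. The tree $(t\circ_1 t)\circ_1 t=t\circ_1(t\circ_1 t)$, with its two occurrences of $t\circ_1 t$, is an SCM of $\ell m(\alpha)$ with itself. It is the only one in which two different copies of $t\circ_1 t$ share an internal node. Its S-polynomial is, up to sign (the order of the two copies), $\alpha\circ_1 t-t\circ_1\alpha$. 4. The S-polynomial $\alpha\circ_1 t-t\circ_1\alpha$ reduces to $0$ by $\alpha$. So does the S-polynomial of every other SCM of $\ell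 m(\alpha)$ with itself. -/

import Mathlib

/-- Ternary trees: rooted plane trees in which every node is a leaf or has exactly three
(ordered) children. -/
inductive TTree : Type
  | leaf : TTree
  | node : TTree → TTree → TTree → TTree

namespace TTree

/-- The basic tree `t` with one internal node. -/
def t : TTree := node leaf leaf leaf

/-- Number of internal nodes. -/
def weight : TTree → ℕ
  | leaf => 0
  | node a b c => weight a + weight b + weight c + 1

/-- Number of leaves; the leaves are indexed `1, …, arity` from left to right. -/
def arity : TTree → ℕ
  | leaf => 1
  | node a b c => arity a + arity b + arity c

/-- `graft p i q` identifies leaf `i` of `p` with the root of `q`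
(meaningful for `1 ≤ i ≤ arity p`, the only range in which it is used). -/
def graft : TTree → ℕ → TTree → TTree
  | leaf, _, q => q
  | node a b c, i, q =>
      if i ≤ arity a then node (graft a i q) b c
      else if i ≤ arity a + arity b then node a (graft b (i - arity a) q) c
      else node a b (graft c (i - arity a - arity b) q)

/-- Number of internal nodes of `p` that come after leaf `i` when the vertices of `p` are listed
in planar preorder (a node first, then its three subtrees from left to right). -/
def nodesAfter : TTree → ℕ → ℕ
  | leaf, _ => 0
  | node a b c, i =>
      if i ≤ arity a then nodesAfter a i + weight b + weight c
      else if i ≤ arity a + arity b then nodesAfter b (i - arity a) + weight c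
      else nodesAfter c (i - arity a - arity b)

/-- The path sequence: the distances from the root to the leaves, from left to right. -/
def path : TTree → List ℕ
  | leaf => [0]
  | node a b c => (path a ++ path b ++ path c).map (· + 1)

/-- The internal nodes of a tree, each given by its address, i.e. the list of child
indices `0, 1, 2` followed on the way from the root to the node. -/
def nodes : TTree → Set (List (Fin 3))
  | leaf => ∅
  | node a b c =>
      {[]} ∪ (List.cons 0) '' nodes a ∪ (List.cons 1) '' nodes b ∪ (List.cons 2) '' nodes c

/-- The address of leaf `i`. -/
def leafAddr : TTree → ℕ → List (Fin 3)
  | leaf, _ => []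
  | node a b c, i =>
      if i ≤ arity a then 0 :: leafAddr a i
      else if i ≤ arity a + arity b then 1 :: leafAddr b (i - arity a)
      else 2 :: leafAddr c (i - arity a - arity b)

end TTree

namespace TernaryOperad

open TTree

/-- Sequences of partial compositions with parentheses, applied to one distinguished argument:
`hole` is the argument itself, `after C i r` is `(⋯) ∘ᵢ r`, `into r i C` is `r ∘ᵢ (⋯)`. -/
inductive Ctx : Type
  | hole : Ctx
  | after : Ctx → ℕ → TTree → Ctx
  | into : TTree → ℕ → Ctx → Ctx

namespace Ctx

/-- The tree `⋯ p ⋯`. -/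
def plug : Ctx → TTree → TTree
  | hole, p => p
  | after C i r, p => graft (C.plug p) i r
  | into r i C, p => graft r i (C.plug p)

/-- All leaf indices occurring in `⋯ p ⋯` are in the proper range. -/
def Valid : Ctx → TTree → Prop
  | hole, _ => True
  | after C i _, p => C.Valid p ∧ 1 ≤ i ∧ i ≤ arity (C.plug p)
  | into r i C, p => C.Valid p ∧ 1 ≤ i ∧ i ≤ arity r

/-- The address in `⋯ p ⋯` of the root of the distinguished copy of `p`. -/
def pos : Ctx → List (Fin 3)
  | hole => []
  | after C _ _ => C.pos
  | into r i C => leafAddr r i ++ C.pos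

/-- The nodes of `⋯ p ⋯` that belong to the distinguished copy of `p`. -/
def occNodes (C : Ctx) (p : TTree) : Set (List (Fin 3)) := (fun u => C.pos ++ u) '' nodes p

end Ctx

/-- `p ∣ q`: the tree `p` is a subtree of `q`, i.e. `q = ⋯ p ⋯`. -/
def Divides (p q : TTree) : Prop := ∃ C : Ctx, C.Valid p ∧ C.plug p = q

noncomputable section

variable (K : Type*) [Field K]

/-- The direct sum `LT` of the spaces `LT(n)`: the vector space with basis all ternary trees. -/
abbrev TreePoly : Type _ := TTree →₀ K

variable {K}

/-- A tree, as a basis vector. -/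
def mono (p : TTree) : TreePoly K := Finsupp.single p 1

/-- `f ∈ LT(n)`, i.e. `f` is a tree polynomial of arity `n`. -/
def IsHomog (n : ℕ) (f : TreePoly K) : Prop := ∀ p ∈ f.support, arity p = n

/-- The Koszul sign of the composition `p ∘ᵢ q` when the generator `t` has degree `d`, so that a
tree `p` has degree `d * weight p`. A tree stands for the word of its nodes in planar preorder;
to bring the word of the composite into this order, `q` moves to the left past the nodes
of `p` that come after leaf `i`. -/
def koszul (d : ℤ) (p : TTree) (i : ℕ) (q : TTree) : K :=
  (-1 : K) ^ ((d * (nodesAfter p i : ℤ)) * (d * (weight q : ℤ)))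

/-- The partial composition `f ∘ᵢ g` in the free nonsymmetric operad on one ternary operation of
degree `d`, bilinear in `f` and `g`. It is used for `f ∈ LT(m)` with `1 ≤ i ≤ m`. -/
def comp (d : ℤ) (f : TreePoly K) (i : ℕ) (g : TreePoly K) : TreePoly K :=
  f.sum fun p a => g.sum fun q b => Finsupp.single (graft p i q) (koszul d p i q * (a * b))

/-- Homogeneous subspaces of `LT` closed under partial composition, on either side,
with arbitrary elements. -/
structure IsOperadIdeal (d : ℤ) (S : Submodule K (TreePoly K)) : Prop where
  homogeneous : ∀ f ∈ S, ∀ n : ℕ, f.filter (fun p => arity p = n) ∈ S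
  comp_right : ∀ (m n : ℕ) (f g : TreePoly K) (i : ℕ), f ∈ S → IsHomog m f → IsHomog n g →
    1 ≤ i → i ≤ m → comp d f i g ∈ S
  comp_left : ∀ (m n : ℕ) (f g : TreePoly K) (j : ℕ), f ∈ S → IsHomog m f → IsHomog n g →
    1 ≤ j → j ≤ n → comp d g j f ∈ S

/-- The operad ideal `⟨G⟩` generated by `G`. -/
def idealSpan (d : ℤ) (G : Set (TreePoly K)) : Submodule K (TreePoly K) :=
  sInf {S | IsOperadIdeal d S ∧ G ⊆ S}

/-- `p` is the leading monomial of the (nonzero, homogeneous) tree polynomial `f`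
in path-lex order. -/
def IsLM (f : TreePoly K) (p : TTree) : Prop :=
  p ∈ f.support ∧ ∀ q ∈ f.support, arity q = arity p ∧ (q = p ∨ path q < path p)

/-- `⋯ f ⋯`, the partial compositions of `C` applied to a tree polynomial `f`. -/
def Ctx.apply (d : ℤ) : Ctx → TreePoly K → TreePoly K
  | .hole, f => f
  | .after C i r, f => comp d (C.apply d f) i (mono r)
  | .into r i C, f => comp d (mono r) i (C.apply d f)

/-- The sign with which `⋯ p ⋯`, computed in `LT`, equals the basis tree `C.plug p`. -/
def Ctx.sign (d : ℤ) : Ctx → TTree → K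
  | .hole, _ => 1
  | .after C i r, p => C.sign d p * koszul d (C.plug p) i r
  | .into r i C, p => C.sign d p * koszul d r i (C.plug p)

/-- `M(q, p, f)` for the occurrence `q = ⋯ p ⋯` of `p` in `q` given by `C`: the copy of `p`
is replaced by `f`. The overall sign is the one for which replacing `p` by `p` gives `q`. -/
def M (d : ℤ) (C : Ctx) (p : TTree) (f : TreePoly K) : TreePoly K := (C.sign d p : K) • C.apply d f

/-- `f'` is obtained from `f` by eliminating the leading term of `f`
with an element `g` of `G`. -/
def ReducesStep (d : ℤ) (G : Set (TreePoly K)) (f f' : TreePoly K) : Prop :=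
  ∃ g ∈ G, ∃ (q p : TTree) (C : Ctx), IsLM f q ∧ IsLM g p ∧ C.Valid p ∧ C.plug p = q ∧
    f' = f - (f q / g p) • M d C p g

/-- `f` can be transformed into `f'` by successive reductions by elements of `G`. -/
def ReducesTo (d : ℤ) (G : Set (TreePoly K)) : TreePoly K → TreePoly K → Prop :=
  Relation.ReflTransGen (ReducesStep d G)

/-- `G` is a Gröbner basis for `I`. -/
structure IsGroebnerBasis (d : ℤ) (G : Set (TreePoly K)) (I : Submodule K (TreePoly K)) : Prop where
  finite : G.Finite
  relations : ∀ g ∈ G, g ≠ 0 ∧ ∃ n, IsHomog n g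
  ideal_eq : I = idealSpan d G
  divides : ∀ f ∈ I, f ≠ 0 → ∀ n, IsHomog n f →
    ∃ g ∈ G, ∃ p q, IsLM g p ∧ IsLM f q ∧ Divides p q

/-- `p` is a small common multiple of `q` and `r`, with the copies of `q` and `r` in `p`
given by `C` and `D`. -/
structure IsSCM (q r p : TTree) (C D : Ctx) : Prop where
  valid_left : C.Valid q
  plug_left : C.plug q = p
  valid_right : D.Valid r
  plug_right : D.plug r = p
  cover : nodes p ⊆ C.occNodes q ∪ D.occNodes r
  small : arity p < arity q + arity r

/-- The S-polynomial of `g` and `h`, with leading monomials `q` and `r`, for the small common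
multiple given by `C` and `D`. -/
def sPoly (d : ℤ) (q r : TTree) (C D : Ctx) (g h : TreePoly K) : TreePoly K := M d C q g - M d D r h

/-- Ternary partial associativity `α = t ∘₁ t + t ∘₂ t + t ∘₃ t`. -/
def alpha (d : ℤ) : TreePoly K :=
  comp d (mono t) 1 (mono t) + comp d (mono t) 2 (mono t) + comp d (mono t) 3 (mono t)

end

end TernaryOperad

open TTree TernaryOperad

/-! Modulo `α`, a node whose first child is a node is, up to sign, a sum of two trees whose leftmost
leaf is one level closer to the root. The Gröbner property is not derived from the S-polynomial by a
Buchberger-type criterion. Instead the rewriting is turned into a trilinear product `muLin`, defined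
by recursion on the first argument, and this product is shown to be partially associative
(`muLin_assoc`). The generator has odd degree, so `sgn_muLin` carries a minus sign, and this makes
the cross terms in that computation cancel.

Reading every node as `muLin` gives a linear map `nfLin`. It kills the ideal
(`idealSpan_le_relSpan`, `nfLin_eq_zero`), it fixes each tree in which all first children are leaves
(`nf_of_leftLeaf`), and it sends a tree to a combination of that tree and smaller ones
(`nf_mem_supp`). If an element of the ideal had a leading monomial of the fixed kind, its leading
coefficient would survive in its image, which is 0. Hence every leading monomial in the ideal
contains `t ∘₁ t`.

Reduction to 0 then holds for every homogeneous element of the ideal, in particular for every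
S-polynomial: a reduction stays in the ideal and lowers the leading monomial, and there are finitely
many trees of a given arity (`reducesTo_zero`).

The composition rules come from counting the nodes after a leaf. The uniqueness of the overlap comes
from locating the two copies by their addresses and counting nodes. -/

namespace TTree

/-! ### Weight, arity and iterated grafting. -/

theorem arity_eq (p : TTree) : arity p = 2 * weight p + 1 := by
  induction p with
  | leaf => rfl
  | node a b c iha ihb ihc => simp only [arity, weight]; omega

theorem arity_pos (p : TTree) : 1 ≤ arity p := by
  have := arity_eq p; omega

theorem weight_graft (p : TTree) (i : ℕ) (q : TTree) :
    weight (graft p i q) = weight p + weight q := by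
  induction p generalizing i with
  | leaf => simp [graft, weight]
  | node a b c iha ihb ihc =>
    simp only [graft]
    split_ifs <;> simp only [weight, iha, ihb, ihc] <;> omega

theorem arity_graft (p : TTree) (i : ℕ) (q : TTree) :
    arity (graft p i q) + 1 = arity p + arity q := by
  simp only [arity_eq, weight_graft]; omega

theorem graft_leaf (p : TTree) (i : ℕ) : graft p i leaf = p := by
  induction p generalizing i with
  | leaf => rfl
  | node a b c iha ihb ihc => simp only [graft, iha, ihb, ihc, ite_self]

theorem eq_leaf_of_weight_eq_zero {p : TTree} (h : weight p = 0) : p = leaf := by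
  cases p with
  | leaf => rfl
  | node a b c => simp [weight] at h

theorem eq_t_of_weight_eq_one {p : TTree} (h : weight p = 1) : p = t := by
  cases p with
  | leaf => simp [weight] at h
  | node a b c =>
    simp only [weight] at h
    rw [eq_leaf_of_weight_eq_zero (p := a) (by omega), eq_leaf_of_weight_eq_zero (p := b) (by omega),
      eq_leaf_of_weight_eq_zero (p := c) (by omega), t]

theorem graft_of_le {a : TTree} (b c : TTree) {i : ℕ} (q : TTree) (h : i ≤ arity a) :
    graft (node a b c) i q = node (graft a i q) b c := by
  simp [graft, h]

theorem graft_of_le_add {a b : TTree} (c : TTree) {i : ℕ} (q : TTree) (h : arity a < i)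
    (h' : i ≤ arity a + arity b) :
    graft (node a b c) i q = node a (graft b (i - arity a) q) c := by
  simp [graft, Nat.not_le.2 h, h']

theorem graft_of_lt {a b : TTree} (c : TTree) {i : ℕ} (q : TTree) (h : arity a + arity b < i) :
    graft (node a b c) i q = node a b (graft c (i - arity a - arity b) q) := by
  have : arity a < i := by omega
  simp [graft, Nat.not_le.2 h, Nat.not_le.2 this]

theorem nodesAfter_of_le {a : TTree} (b c : TTree) {i : ℕ} (h : i ≤ arity a) :
    nodesAfter (node a b c) i = nodesAfter a i + weight b + weight c := by
  simp [nodesAfter, h]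

theorem nodesAfter_of_le_add {a b : TTree} (c : TTree) {i : ℕ} (h : arity a < i)
    (h' : i ≤ arity a + arity b) :
    nodesAfter (node a b c) i = nodesAfter b (i - arity a) + weight c := by
  simp [nodesAfter, Nat.not_le.2 h, h']

theorem nodesAfter_of_lt {a b : TTree} (c : TTree) {i : ℕ} (h : arity a + arity b < i) :
    nodesAfter (node a b c) i = nodesAfter c (i - arity a - arity b) := by
  have : arity a < i := by omega
  simp [nodesAfter, Nat.not_le.2 h, Nat.not_le.2 this]

/-- Sequential composition of trees, together with the count of the nodes after a leaf. -/
theorem graft_graft_of_mem (p q r : TTree) (i j : ℕ) (hi : 1 ≤ i) (hip : i ≤ arity p)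
    (hij : i ≤ j) (hj : j ≤ i + arity q - 1) :
    graft (graft p i q) j r = graft p i (graft q (j - i + 1) r) ∧
      nodesAfter (graft p i q) j = nodesAfter q (j - i + 1) + nodesAfter p i := by
  induction p generalizing i j with
  | leaf =>
    obtain rfl : i = 1 := by simp only [arity] at hip; omega
    simp [graft, nodesAfter, Nat.sub_add_cancel hij]
  | node a b c iha ihb ihc =>
    have hq := arity_pos q
    simp only [arity] at hip
    rcases le_or_gt i (arity a) with h1 | h1
    · have e := arity_graft a i q
      obtain ⟨e1, e2⟩ := iha i j hi h1 hij hj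
      rw [graft_of_le _ _ _ h1, graft_of_le _ _ _ h1, graft_of_le _ _ _ (by omega), e1,
        nodesAfter_of_le _ _ (by omega), nodesAfter_of_le _ _ h1, e2]
      exact ⟨rfl, by omega⟩
    rcases le_or_gt i (arity a + arity b) with h2 | h2
    · have e := arity_graft b (i - arity a) q
      obtain ⟨e1, e2⟩ := ihb (i - arity a) (j - arity a) (by omega) (by omega) (by omega) (by omega)
      rw [show j - arity a - (i - arity a) + 1 = j - i + 1 by omega] at e1 e2
      rw [graft_of_le_add _ _ h1 h2, graft_of_le_add _ _ h1 h2,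
        graft_of_le_add _ _ (by omega) (by omega), e1,
        nodesAfter_of_le_add _ (by omega) (by omega), nodesAfter_of_le_add _ h1 h2, e2]
      exact ⟨rfl, by omega⟩
    · have e := arity_graft c (i - arity a - arity b) q
      obtain ⟨e1, e2⟩ := ihc (i - arity a - arity b) (j - arity a - arity b) (by omega) (by omega)
        (by omega) (by omega)
      rw [show j - arity a - arity b - (i - arity a - arity b) + 1 = j - i + 1 by omega] at e1 e2
      rw [graft_of_lt _ _ h2, graft_of_lt _ _ h2,
        graft_of_lt _ _ (by omega), e1,
        nodesAfter_of_lt _ (by omega), nodesAfter_of_lt _ h2, e2]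
      exact ⟨rfl, rfl⟩

/-- Parallel composition of trees, together with the counts of the nodes after a leaf. -/
theorem graft_graft_of_lt (p q r : TTree) (i j : ℕ) (hi : 1 ≤ i) (hij : i < j)
    (hj : j ≤ arity p) :
    graft (graft p i q) (j + arity q - 1) r = graft (graft p j r) i q ∧
      nodesAfter (graft p i q) (j + arity q - 1) = nodesAfter p j ∧
      nodesAfter (graft p j r) i = nodesAfter p i + weight r := by
  induction p generalizing i j with
  | leaf => simp only [arity] at hj; omega
  | node a b c iha ihb ihc =>
    have hq := arity_pos q
    have hr := arity_pos r
    simp only [arity] at hj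
    rcases le_or_gt i (arity a) with h1 | h1
    · have e := arity_graft a i q
      rw [graft_of_le _ _ _ h1, nodesAfter_of_le _ _ h1]
      rcases le_or_gt j (arity a) with k1 | k1
      · have e' := arity_graft a j r
        obtain ⟨e1, e2, e3⟩ := iha i j hi hij k1
        rw [graft_of_le _ _ _ k1, graft_of_le _ _ _ (by omega), graft_of_le _ _ _ (by omega), e1,
          nodesAfter_of_le _ _ (by omega), nodesAfter_of_le _ _ (by omega),
          nodesAfter_of_le _ _ (by omega), e2, e3]
        exact ⟨rfl, rfl, by omega⟩
      rcases le_or_gt j (arity a + arity b) with k2 | k2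
      · rw [graft_of_le_add _ _ k1 k2, graft_of_le _ _ _ h1,
          graft_of_le_add _ _ (by omega) (by omega), nodesAfter_of_le _ _ h1,
          nodesAfter_of_le_add _ k1 k2, nodesAfter_of_le_add _ (by omega) (by omega), weight_graft,
          show j + arity q - 1 - arity (graft a i q) = j - arity a by omega]
        exact ⟨rfl, rfl, by omega⟩
      · rw [graft_of_lt _ _ k2, graft_of_le _ _ _ h1, graft_of_lt _ _ (by omega),
          nodesAfter_of_le _ _ h1, nodesAfter_of_lt _ k2, nodesAfter_of_lt _ (by omega),
          weight_graft, show j + arity q - 1 - arity (graft a i q) - arity b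
            = j - arity a - arity b by omega]
        exact ⟨rfl, rfl, by omega⟩
    rcases le_or_gt i (arity a + arity b) with h2 | h2
    · have e := arity_graft b (i - arity a) q
      rw [graft_of_le_add _ _ h1 h2, nodesAfter_of_le_add _ h1 h2]
      rcases le_or_gt j (arity a + arity b) with k2 | k2
      · have e' := arity_graft b (j - arity a) r
        obtain ⟨e1, e2, e3⟩ := ihb (i - arity a) (j - arity a) (by omega) (by omega) (by omega)
        rw [show j - arity a + arity q - 1 = j + arity q - 1 - arity a by omega] at e1 e2
        rw [graft_of_le_add _ _ (by omega) k2, graft_of_le_add _ _ (by omega) (by omega),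
          graft_of_le_add _ _ (by omega) (by omega), e1,
          nodesAfter_of_le_add _ (by omega) (by omega), nodesAfter_of_le_add _ (by omega) (by omega),
          nodesAfter_of_le_add _ (by omega) (by omega), e2, e3]
        exact ⟨rfl, rfl, by omega⟩
      · rw [graft_of_lt _ _ k2, graft_of_le_add _ _ h1 h2, graft_of_lt _ _ (by omega),
          nodesAfter_of_le_add _ h1 h2, nodesAfter_of_lt _ k2, nodesAfter_of_lt _ (by omega),
          weight_graft, show j + arity q - 1 - arity a - arity (graft b (i - arity a) q)
            = j - arity a - arity b by omega]
        exact ⟨rfl, rfl, by omega⟩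
    · obtain ⟨e1, e2, e3⟩ := ihc (i - arity a - arity b) (j - arity a - arity b) (by omega)
        (by omega) (by omega)
      rw [show j - arity a - arity b + arity q - 1 = j + arity q - 1 - arity a - arity b
        by omega] at e1 e2
      rw [graft_of_lt _ _ h2, nodesAfter_of_lt _ h2, graft_of_lt (i := j) _ _ (by omega),
        graft_of_lt _ _ (by omega), graft_of_lt _ _ h2, e1,
        nodesAfter_of_lt _ (by omega), nodesAfter_of_lt (i := j) _ (by omega),
        nodesAfter_of_lt _ (by omega), e2, e3]
      exact ⟨rfl, rfl, rfl⟩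

/-! ### The path-lex order -/

theorem length_path (p : TTree) : (path p).length = arity p := by
  induction p with
  | leaf => rfl
  | node a b c iha ihb ihc => simp [path, arity, iha, ihb, ihc, Nat.add_assoc]

theorem path_ne_nil (p : TTree) : path p ≠ [] := by
  have h := length_path p
  have := arity_pos p
  intro h'
  rw [h'] at h
  simp only [List.length_nil] at h
  omega

/-- Path sequences form a prefix code. The shift `k` records the depth of the root and the tails
record what is still to be read; the first entry is `k` for a leaf and larger for a node. -/
theorem map_path_append_inj (p q : TTree) (k : ℕ) (l l' : List ℕ)
    (h : (path p).map (· + k) ++ l = (path q).map (· + k) ++ l') : p = q ∧ l = l' := by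
  have pos : ∀ (a b c : TTree) (l l' : List ℕ) (k : ℕ),
      (path (node a b c)).map (· + k) ++ l ≠ [0 + k] ++ l' := by
    intro a b c l l' k h
    obtain ⟨x, xs, hx⟩ := List.exists_cons_of_ne_nil (path_ne_nil a)
    simp only [path, hx, List.map_append, List.map_cons, List.cons_append, List.nil_append,
      List.append_assoc, List.cons.injEq] at h
    omega
  induction p generalizing q k l l' with
  | leaf =>
    cases q with
    | leaf => simpa [path] using h
    | node a b c => exact (pos a b c _ _ _ h.symm).elim
  | node a b c iha ihb ihc =>
    cases q with
    | leaf => exact (pos a b c _ _ _ h).elim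
    | node a' b' c' =>
      have e : ((· + k) ∘ (· + 1) : ℕ → ℕ) = (· + (k + 1)) := by
        funext x; simp only [Function.comp_apply]; omega
      simp only [path, List.map_append, List.map_map, List.append_assoc, e] at h
      obtain ⟨rfl, h₁⟩ := iha _ _ _ _ h
      obtain ⟨rfl, h₂⟩ := ihb _ _ _ _ h₁
      obtain ⟨rfl, h₃⟩ := ihc _ _ _ _ h₂
      exact ⟨rfl, h₃⟩

theorem path_injective : Function.Injective path := fun p q h =>
  (map_path_append_inj p q 0 [] [] (by simp [h])).1

/-- Equal lengths exclude the case where `l` is a proper prefix of `l'`, in which the tails would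
decide. -/
theorem lt_append_of_lt {l l' : List ℕ} (h : l < l') (hl : l.length = l'.length) (m m' : List ℕ) :
    l ++ m < l' ++ m' := by
  induction l generalizing l' with
  | nil => cases l' <;> simp_all
  | cons x xs ih =>
    cases l' with
    | nil => simp at hl
    | cons y ys =>
      simp only [List.cons_append, List.cons_lt_cons_iff] at h ⊢
      rcases h with h | ⟨h, h'⟩
      · exact Or.inl h
      · exact Or.inr ⟨h, ih h' (by simpa using hl)⟩

theorem append_lt_append_left (l : List ℕ) {m m' : List ℕ} (h : m < m') : l ++ m < l ++ m' := by
  induction l with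
  | nil => simpa
  | cons x xs ih => simpa [List.cons_lt_cons_iff] using ih

theorem map_succ_lt {l l' : List ℕ} (h : l < l') : l.map (· + 1) < l'.map (· + 1) := by
  induction l generalizing l' with
  | nil => cases l' <;> simp_all
  | cons x xs ih =>
    cases l' with
    | nil => simp at h
    | cons y ys =>
      simp only [List.map_cons, List.cons_lt_cons_iff] at h ⊢
      rcases h with h | ⟨h, h'⟩
      · exact Or.inl (by omega)
      · exact Or.inr ⟨by omega, ih h'⟩

/-- `p` is of the same arity as `q` and strictly smaller in path-lex order. -/
def Smaller (p q : TTree) : Prop := arity p = arity q ∧ path p < path q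

theorem Smaller.trans {p q r : TTree} (h : Smaller p q) (h' : Smaller q r) : Smaller p r :=
  ⟨h.1.trans h'.1, lt_trans h.2 h'.2⟩

theorem Smaller.left {a a' : TTree} (h : Smaller a' a) (b b' c c' : TTree)
    (hbc : arity b' + arity c' = arity b + arity c) : Smaller (node a' b' c') (node a b c) := by
  refine ⟨by simp only [arity]; have := h.1; omega, ?_⟩
  simp only [path, List.append_assoc]
  exact map_succ_lt (lt_append_of_lt h.2 (by simp only [length_path, h.1]) _ _)

theorem Smaller.middle (a : TTree) {b b' : TTree} (h : Smaller b' b) (c c' : TTree)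
    (hc : arity c' = arity c) : Smaller (node a b' c') (node a b c) := by
  refine ⟨by simp only [arity, h.1, hc], ?_⟩
  simp only [path, List.append_assoc]
  exact map_succ_lt (append_lt_append_left _
    (lt_append_of_lt h.2 (by simp only [length_path, h.1]) _ _))

theorem Smaller.right (a b : TTree) {c c' : TTree} (h : Smaller c' c) :
    Smaller (node a b c') (node a b c) := by
  refine ⟨by simp only [arity, h.1], ?_⟩
  simp only [path, List.append_assoc]
  exact map_succ_lt (append_lt_append_left _ (append_lt_append_left _ h.2))

/-- The leftmost leaf of `e` comes first on both sides and is one level higher on the left, so the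
first entry decides whatever the other subtrees are. This makes `t ∘₁ t` the leading monomial of
`α`. -/
theorem smaller_of_left_assoc (e x y b c b' c' : TTree)
    (h : arity b' + arity c' = arity x + arity y + arity b + arity c) :
    Smaller (node e b' c') (node (node e x y) b c) := by
  refine ⟨by simp only [arity]; omega, ?_⟩
  obtain ⟨u, us, hu⟩ := List.exists_cons_of_ne_nil (path_ne_nil e)
  simp only [path, hu, List.map_append, List.cons_append, List.map_cons, List.cons_lt_cons_iff]
  exact Or.inl (by omega)

/-- `p` equals `q` or is of the same arity and smaller in path-lex order. -/
def AtMost (p q : TTree) : Prop := p = q ∨ Smaller p q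

theorem AtMost.arity_eq {p q : TTree} (h : AtMost p q) : arity p = arity q := by
  rcases h with rfl | h
  exacts [rfl, h.1]

theorem AtMost.trans {p q r : TTree} (h : AtMost p q) (h' : AtMost q r) : AtMost p r := by
  rcases h with rfl | h
  · exact h'
  rcases h' with rfl | h'
  · exact Or.inr h
  · exact Or.inr (h.trans h')

theorem AtMost.node {a a' b b' c c' : TTree} (ha : AtMost a' a) (hb : AtMost b' b)
    (hc : AtMost c' c) : AtMost (node a' b' c') (node a b c) := by
  have eb := hb.arity_eq
  have ec := hc.arity_eq
  rcases ha with rfl | ha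
  · rcases hb with rfl | hb
    · rcases hc with rfl | hc
      · exact Or.inl rfl
      · exact Or.inr (hc.right _ _)
    · exact Or.inr (hb.middle _ _ _ ec)
  · exact Or.inr (ha.left _ _ _ _ (by omega))

/-! ### Finiteness in each arity, and the irreducible trees. -/

theorem finite_weight_le (n : ℕ) : {p : TTree | weight p ≤ n}.Finite := by
  induction n with
  | zero =>
    refine (Set.finite_singleton leaf).subset fun p hp => ?_
    exact eq_leaf_of_weight_eq_zero (Nat.le_zero.1 hp)
  | succ n ih =>
    refine ((Set.finite_singleton leaf).union (Set.Finite.image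
      (fun x : TTree × TTree × TTree => TTree.node x.1 x.2.1 x.2.2) (ih.prod (ih.prod ih)))).subset ?_
    rintro (_ | ⟨a, b, c⟩) hp
    · exact Or.inl rfl
    · simp only [Set.mem_ofPred_eq, weight] at hp
      refine Or.inr ⟨(a, b, c), ?_, rfl⟩
      simp only [Set.mem_prod, Set.mem_ofPred_eq]
      omega

theorem finite_arity_eq (n : ℕ) : {p : TTree | arity p = n}.Finite := by
  refine (finite_weight_le n).subset fun p hp => ?_
  have := arity_eq p
  simp only [Set.mem_ofPred_eq] at hp ⊢
  omega

/-- The trees in which every first child is a leaf, i.e. those not divisible by `t ∘₁ t`. -/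
def LeftLeaf : TTree → Prop
  | leaf => True
  | node a b c => a = leaf ∧ LeftLeaf b ∧ LeftLeaf c

end TTree

namespace TernaryOperad

noncomputable section

variable {K : Type*} [Field K]

/-! ### Linear and trilinear maps given on trees -/

theorem mono_induction {P : TreePoly K → Prop} (f : TreePoly K) (zero : P 0)
    (add : ∀ f g, P f → P g → P (f + g)) (smul : ∀ (a : K) f, P f → P (a • f))
    (mono : ∀ p, P (mono p)) : P f := by
  induction f using Finsupp.induction_linear with
  | zero => exact zero
  | add f g hf hg => exact add f g hf hg
  | single p a =>
    have : Finsupp.single p a = a • (TernaryOperad.mono p : TreePoly K) := by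
      simp [TernaryOperad.mono]
    rw [this]
    exact smul _ _ (mono p)

/-- The tree polynomials whose monomials all lie in `s`. -/
abbrev supp (K : Type*) [Field K] (s : Set TTree) : Submodule K (TreePoly K) :=
  Finsupp.supported K K s

theorem mono_mem_supp {s : Set TTree} {p : TTree} (h : p ∈ s) : (mono p : TreePoly K) ∈ supp K s :=
  Finsupp.single_mem_supported K 1 h

theorem supp_eq_span (s : Set TTree) :
    supp K s = Submodule.span K ((fun p => (mono p : TreePoly K)) '' s) :=
  Finsupp.supported_eq_span_single K s

@[elab_as_elim]
-- Reduces linear claims about homogeneous elements to trees of one fixed arity, which is what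
-- determines the subtree containing leaf `i` after insertion into a node.
theorem supp_induction {s : Set TTree} {P : (f : TreePoly K) → f ∈ supp K s → Prop}
    (zero : P 0 (Submodule.zero_mem _))
    (add : ∀ f g hf hg, P f hf → P g hg → P (f + g) (Submodule.add_mem _ hf hg))
    (smul : ∀ (a : K) f hf, P f hf → P (a • f) (Submodule.smul_mem _ a hf))
    (mono : ∀ p (hp : p ∈ s), P (mono p) (mono_mem_supp hp)) {f : TreePoly K}
    (hf : f ∈ supp K s) : P f hf := by
  suffices ∃ h : f ∈ supp K s, P f h from this.2
  have hf' := hf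
  rw [supp_eq_span] at hf'
  induction hf' using Submodule.span_induction with
  | mem x hx => obtain ⟨p, hp, rfl⟩ := hx; exact ⟨_, mono p hp⟩
  | zero => exact ⟨_, zero⟩
  | add f g h h' ihf ihg =>
    rw [← supp_eq_span] at h h'
    exact ⟨_, add f g h h' (ihf h).2 (ihg h').2⟩
  | smul a f h ihf =>
    rw [← supp_eq_span] at h
    exact ⟨_, smul a f h (ihf h).2⟩

theorem isHomog_iff {n : ℕ} {f : TreePoly K} : IsHomog n f ↔ f ∈ supp K {p | arity p = n} := by
  rw [Finsupp.mem_supported]; rfl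

theorem map_mem_of_mem_supp {s : Set TTree} {f : TreePoly K} (hf : f ∈ supp K s)
    (F : TreePoly K →ₗ[K] TreePoly K) {W : Submodule K (TreePoly K)}
    (h : ∀ p ∈ s, F (mono p) ∈ W) : F f ∈ W := by
  induction hf using supp_induction with
  | zero => simp
  | add f g _ _ hf hg => rw [map_add]; exact W.add_mem hf hg
  | smul a f _ hf => rw [map_smul]; exact W.smul_mem a hf
  | mono p hp => exact h p hp

/-- The trilinear map with prescribed values on trees. -/
def trilin (φ : TTree → TTree → TTree → TreePoly K) :
    TreePoly K →ₗ[K] TreePoly K →ₗ[K] TreePoly K →ₗ[K] TreePoly K :=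
  Finsupp.linearCombination K fun a => Finsupp.linearCombination K fun b =>
    Finsupp.linearCombination K fun c => φ a b c

@[simp] theorem trilin_mono (φ : TTree → TTree → TTree → TreePoly K) (a b c : TTree) :
    trilin φ (mono a) (mono b) (mono c) = φ a b c := by
  simp [trilin, mono]

theorem trilin_mem (φ : TTree → TTree → TTree → TreePoly K) {A B C : Set TTree}
    {f g h : TreePoly K} (hf : f ∈ supp K A) (hg : g ∈ supp K B) (hh : h ∈ supp K C)
    {W : Submodule K (TreePoly K)} (H : ∀ a ∈ A, ∀ b ∈ B, ∀ c ∈ C, φ a b c ∈ W) :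
    trilin φ f g h ∈ W := by
  refine map_mem_of_mem_supp hf (((trilin φ).flip g).flip h) fun a ha => ?_
  refine map_mem_of_mem_supp hg ((trilin φ (mono a)).flip h) fun b hb => ?_
  refine map_mem_of_mem_supp hh (trilin φ (mono a) (mono b)) fun c hc => ?_
  rw [trilin_mono]
  exact H a ha b hb c hc

/-- The trilinear extension of `TTree.node`. -/
def nd : TreePoly K →ₗ[K] TreePoly K →ₗ[K] TreePoly K →ₗ[K] TreePoly K :=
  trilin fun a b c => mono (node a b c)

@[simp] theorem nd_mono (a b c : TTree) :
    nd (mono a) (mono b) (mono c) = (mono (node a b c) : TreePoly K) := trilin_mono _ _ _ _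

/-- The sign operator `p ↦ (-1) ^ weight p • p`. -/
def sgn : TreePoly K →ₗ[K] TreePoly K :=
  Finsupp.linearCombination K fun p => (-1 : K) ^ weight p • mono p

@[simp] theorem sgn_mono (p : TTree) :
    sgn (mono p) = (-1 : K) ^ weight p • (mono p : TreePoly K) := by
  simp [sgn, mono]

theorem sgn_sgn (f : TreePoly K) : sgn (sgn f) = f := by
  induction f using mono_induction with
  | zero => simp
  | add f g hf hg => simp only [map_add, hf, hg]
  | smul a f hf => simp only [map_smul, hf]
  | mono p => simp [smul_smul, ← mul_pow]

theorem sgn_nd (f g h : TreePoly K) : sgn (nd f g h) = -nd (sgn f) (sgn g) (sgn h) := by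
  induction f using mono_induction with
  | zero => simp
  | add f g hf hg => simp only [map_add, LinearMap.add_apply, hf, hg, neg_add]
  | smul a f hf => simp only [map_smul, LinearMap.smul_apply, hf, smul_neg]
  | mono p =>
  induction g using mono_induction with
  | zero => simp
  | add f g hf hg => simp only [map_add, LinearMap.add_apply, hf, hg, neg_add]
  | smul a f hf => simp only [map_smul, LinearMap.smul_apply, hf, smul_neg]
  | mono q =>
  induction h using mono_induction with
  | zero => simp
  | add f g hf hg => simp only [map_add, hf, hg, neg_add]
  | smul a f hf => simp only [map_smul, hf, smul_neg]
  | mono r =>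
    simp only [sgn_mono, nd_mono, map_smul, LinearMap.smul_apply, smul_smul, weight, pow_add,
      pow_one, mul_neg_one, neg_smul]
    congr 2
    ring

/-! ### The multiplication of normal forms -/

/-- `node a b c`, with the left-nested nodes at its root rewritten by `α = 0`. -/
def mu : TTree → TTree → TTree → TreePoly K
  | leaf, b, c => mono (node leaf b c)
  | node e x y, b, c =>
      -nd (sgn (mono e)) (mu x y b) (mono c) - nd (sgn (mono e)) (sgn (mono x)) (mu y b c)

/-- The trilinear extension of `mu`. -/
def muLin : TreePoly K →ₗ[K] TreePoly K →ₗ[K] TreePoly K →ₗ[K] TreePoly K := trilin mu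

@[simp] theorem muLin_mono (a b c : TTree) :
    muLin (mono a) (mono b) (mono c) = (mu a b c : TreePoly K) := trilin_mono _ _ _ _

theorem muLin_leaf (g h : TreePoly K) : muLin (mono leaf) g h = nd (mono leaf) g h := by
  induction g using mono_induction with
  | zero => simp
  | add f g hf hg => simp only [map_add, LinearMap.add_apply, hf, hg]
  | smul a f hf => simp only [map_smul, LinearMap.smul_apply, hf]
  | mono q =>
  induction h using mono_induction with
  | zero => simp
  | add f g hf hg => simp only [map_add, hf, hg]
  | smul a f hf => simp only [map_smul, hf]
  | mono r => simp [mu]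

/-- The recursion of `mu` extends to all arguments because both sides are linear in each of the
five. This is needed since products of trees are no longer trees. -/
theorem muLin_nd (e f g h k : TreePoly K) :
    muLin (nd e f g) h k =
      -nd (sgn e) (muLin f g h) k - nd (sgn e) (sgn f) (muLin g h k) := by
  induction e using mono_induction with
  | zero => simp
  | add f g hf hg => simp only [map_add, LinearMap.add_apply, hf, hg]; abel
  | smul a f hf => simp only [map_smul, LinearMap.smul_apply, hf, smul_sub, smul_neg]
  | mono e =>
  induction f using mono_induction with
  | zero => simp
  | add f g hf hg => simp only [map_add, LinearMap.add_apply, hf, hg]; abel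
  | smul a f hf => simp only [map_smul, LinearMap.smul_apply, hf, smul_sub, smul_neg]
  | mono f =>
  induction g using mono_induction with
  | zero => simp
  | add f g hf hg => simp only [map_add, LinearMap.add_apply, hf, hg]; abel
  | smul a f hf => simp only [map_smul, LinearMap.smul_apply, hf, smul_sub, smul_neg]
  | mono g =>
  induction h using mono_induction with
  | zero => simp
  | add f g hf hg => simp only [map_add, LinearMap.add_apply, hf, hg]; abel
  | smul a f hf => simp only [map_smul, LinearMap.smul_apply, hf, smul_sub, smul_neg]
  | mono h =>
  induction k using mono_induction with
  | zero => simp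
  | add f g hf hg => simp only [map_add, hf, hg]; abel
  | smul a f hf => simp only [map_smul, hf, smul_sub, smul_neg]
  | mono k => simp only [nd_mono, muLin_mono, mu]

/-- Rewriting preserves the number of nodes, so all trees in `mu a b c` have weight one more than
the sum of the three weights; the extra node gives the minus sign. -/
theorem sgn_mu (a b c : TTree) :
    sgn (mu a b c : TreePoly K) =
      -((-1 : K) ^ (weight a + weight b + weight c) • (mu a b c : TreePoly K)) := by
  induction a generalizing b c with
  | leaf =>
    simp only [mu, sgn_mono, weight, pow_succ, zero_add, mul_neg_one, neg_smul]
  | node e x y _ ihx ihy =>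
    simp only [mu, map_sub, map_neg, sgn_nd, ihx, ihy, sgn_mono, map_smul, LinearMap.smul_apply,
      LinearMap.neg_apply, neg_neg, smul_smul, smul_sub, smul_neg, weight, pow_add, pow_one,
      neg_sub, mul_neg_one]
    module

theorem sgn_muLin (f g h : TreePoly K) :
    sgn (muLin f g h) = -muLin (sgn f) (sgn g) (sgn h) := by
  induction f using mono_induction with
  | zero => simp
  | add f g hf hg => simp only [map_add, LinearMap.add_apply, hf, hg, neg_add]
  | smul a f hf => simp only [map_smul, LinearMap.smul_apply, hf, smul_neg]
  | mono p =>
  induction g using mono_induction with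
  | zero => simp
  | add f g hf hg => simp only [map_add, LinearMap.add_apply, hf, hg, neg_add]
  | smul a f hf => simp only [map_smul, LinearMap.smul_apply, hf, smul_neg]
  | mono q =>
  induction h using mono_induction with
  | zero => simp
  | add f g hf hg => simp only [map_add, hf, hg, neg_add]
  | smul a f hf => simp only [map_smul, hf, smul_neg]
  | mono r =>
    simp only [muLin_mono, sgn_mu, sgn_mono, map_smul, LinearMap.smul_apply, smul_smul, pow_add]
    congr 2
    ring

theorem muLin_neg (f g h : TreePoly K) : muLin (-f) g h = -muLin f g h := by
  rw [← neg_one_smul K f, map_smul, LinearMap.smul_apply, LinearMap.smul_apply, neg_one_smul]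

theorem muLin_sub (f f' g h : TreePoly K) :
    muLin (f - f') g h = muLin f g h - muLin f' g h := by
  rw [sub_eq_add_neg, map_add, LinearMap.add_apply, LinearMap.add_apply, muLin_neg,
    ← sub_eq_add_neg]

/-- The multiplication `muLin` is partially associative. -/
theorem muLin_assoc (a x y b c : TreePoly K) :
    muLin (muLin a x y) b c + muLin (sgn a) (muLin x y b) c +
      muLin (sgn a) (sgn x) (muLin y b c) = 0 := by
  induction a using mono_induction with
  | zero => simp
  | add f g hf hg =>
    simp only [map_add, LinearMap.add_apply]
    rw [← add_zero (0 : TreePoly K)]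
    nth_rw 1 [← hf, ← hg]
    abel
  | smul a f hf => simp only [map_smul, LinearMap.smul_apply, ← smul_add, hf, smul_zero]
  | mono p =>
  induction p generalizing x y b c with
  | leaf =>
    simp only [muLin_leaf, muLin_nd, sgn_mono, weight, pow_zero, one_smul]
    abel
  | node e u v _ ihu ihv =>
    -- Expanding all products at the root `e` leaves the relation for `u, v, x, y, b` in the middle
    -- slot, the relation for `v, x, y, b, c` in the last slot, and two terms pairing a product of
    -- `u, v, x` with a product of `y, b, c`. By `sgn_muLin` these two cancel.
    have hu := ihu (mono v) x y b
    have hv := ihv x y b c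
    rw [← nd_mono]
    simp only [muLin_nd, sgn_nd, muLin_sub, muLin_neg, map_neg, LinearMap.neg_apply, sgn_sgn,
      sgn_muLin]
    have hu' := congrArg (fun z => nd (mono e) z c) hu
    have hv' := congrArg (fun z => nd (mono e) (mono u) z) hv
    simp only [map_add, LinearMap.add_apply, map_zero, LinearMap.zero_apply] at hu' hv'
    rw [← add_zero (0 : TreePoly K)]
    nth_rw 1 [← hu', ← hv']
    abel

/-! ### Normal forms -/

/-- The normal form of a tree modulo `α`. -/
def nf : TTree → TreePoly K
  | leaf => mono leaf
  | node a b c => muLin (nf a) (nf b) (nf c)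

/-- The linear extension of `nf`. -/
def nfLin : TreePoly K →ₗ[K] TreePoly K := Finsupp.linearCombination K nf

@[simp] theorem nfLin_mono (p : TTree) : nfLin (mono p : TreePoly K) = nf p := by
  simp [nfLin, mono]

theorem nfLin_nd (f g h : TreePoly K) :
    nfLin (nd f g h) = muLin (nfLin f) (nfLin g) (nfLin h) := by
  induction f using mono_induction with
  | zero => simp
  | add f g hf hg => simp only [map_add, LinearMap.add_apply, hf, hg]
  | smul a f hf => simp only [map_smul, LinearMap.smul_apply, hf]
  | mono p =>
  induction g using mono_induction with
  | zero => simp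
  | add f g hf hg => simp only [map_add, LinearMap.add_apply, hf, hg]
  | smul a f hf => simp only [map_smul, LinearMap.smul_apply, hf]
  | mono q =>
  induction h using mono_induction with
  | zero => simp
  | add f g hf hg => simp only [map_add, hf, hg]
  | smul a f hf => simp only [map_smul, hf]
  | mono r => simp [nf]

/-- Converts the operator `sgn` in `muLin_assoc` into the scalar signs of `assocRel`. -/
theorem sgn_nf (p : TTree) : sgn (nf p : TreePoly K) = (-1 : K) ^ weight p • (nf p : TreePoly K) := by
  induction p with
  | leaf => simp [nf]
  | node a b c iha ihb ihc =>
    simp only [nf, sgn_muLin, iha, ihb, ihc, map_smul, LinearMap.smul_apply, smul_smul, weight,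
      pow_add, pow_one, mul_neg_one, neg_smul]
    congr 2
    ring

/-- Each rewriting at the root raises the leftmost leaf, hence gives smaller trees, and `AtMost` is
compatible with forming nodes. -/
theorem nf_mem_supp (p : TTree) : (nf p : TreePoly K) ∈ supp K {q | AtMost q p} := by
  have mu_mem : ∀ a b c : TTree, (mu a b c : TreePoly K) ∈ supp K {q | AtMost q (node a b c)} := by
    intro a
    induction a with
    | leaf => exact fun b c => mono_mem_supp (Or.inl rfl)
    | node e x y _ ihx ihy =>
      intro b c
      have sgn_mem : ∀ p : TTree, sgn (mono p : TreePoly K) ∈ supp K {p} := fun p => by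
        rw [sgn_mono]; exact Submodule.smul_mem _ _ (mono_mem_supp rfl)
      refine Submodule.sub_mem _ (Submodule.neg_mem _ ?_) ?_
      · refine trilin_mem _ (sgn_mem e) (ihx y b) (mono_mem_supp (Set.mem_singleton c)) ?_
        rintro _ rfl z hz _ rfl
        refine mono_mem_supp (Or.inr (smaller_of_left_assoc _ _ _ _ _ _ _ ?_))
        rw [AtMost.arity_eq hz, arity]
      · refine trilin_mem _ (sgn_mem e) (sgn_mem x) (ihy b c) ?_
        rintro _ rfl _ rfl z hz
        refine mono_mem_supp (Or.inr (smaller_of_left_assoc _ _ _ _ _ _ _ ?_))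
        rw [AtMost.arity_eq hz, arity]
        omega
  induction p with
  | leaf => exact mono_mem_supp (Or.inl rfl)
  | node a b c iha ihb ihc =>
    refine trilin_mem _ iha ihb ihc fun a' ha b' hb c' hc => ?_
    exact Finsupp.supported_mono (fun q hq => AtMost.trans hq (ha.node hb hc)) (mu_mem a' b' c')

theorem nf_of_leftLeaf {p : TTree} (h : LeftLeaf p) : (nf p : TreePoly K) = mono p := by
  induction p with
  | leaf => rfl
  | node a b c iha ihb ihc =>
    obtain ⟨rfl, hb, hc⟩ := h
    simp [nf, ihb hb, ihc hc, mu]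

/-! ### Partial composition as a bilinear map -/

/-- Since `d * d` is odd, only the parities of the node counts matter. -/
theorem koszul_eq {d : ℤ} (hd : Odd d) (p : TTree) (i : ℕ) (q : TTree) :
    (koszul d p i q : K) = (-1 : K) ^ (nodesAfter p i * weight q) := by
  rw [koszul, show d * (nodesAfter p i : ℤ) * (d * (weight q : ℤ))
    = (d * d) * ((nodesAfter p i * weight q : ℕ) : ℤ) by push_cast; ring, zpow_mul,
    (hd.mul hd).neg_one_zpow, zpow_natCast]

/-- Partial composition as a bilinear map. -/
def compLin (d : ℤ) (i : ℕ) : TreePoly K →ₗ[K] TreePoly K →ₗ[K] TreePoly K :=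
  Finsupp.linearCombination K fun p => Finsupp.linearCombination K fun q =>
    (koszul d p i q : K) • mono (graft p i q)

theorem comp_eq_compLin (d : ℤ) (f : TreePoly K) (i : ℕ) (g : TreePoly K) :
    comp d f i g = compLin d i f g := by
  simp only [comp, compLin, Finsupp.linearCombination_apply, Finsupp.sum, LinearMap.sum_apply,
    LinearMap.smul_apply, Finset.smul_sum, mono, Finsupp.smul_single, smul_eq_mul,
    mul_one]
  refine Finset.sum_congr rfl fun p _ => Finset.sum_congr rfl fun q _ => ?_
  congr 1
  ring

@[simp] theorem compLin_mono (d : ℤ) (i : ℕ) (p q : TTree) :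
    compLin d i (mono p) (mono q) = (koszul d p i q : K) • (mono (graft p i q) : TreePoly K) := by
  simp [compLin, mono]

/-- The sign comes from moving `q` past the nodes of `b` and `c`, which follow leaf `i`; the
homogeneity of `f` guarantees that this leaf lies in the first slot for every monomial. -/
theorem compLin_nd_left {d : ℤ} (hd : Odd d) {n : ℕ} {f : TreePoly K}
    (hf : f ∈ supp K {p | arity p = n}) (b c q : TTree) {i : ℕ} (hi : i ≤ n) :
    compLin d i (nd f (mono b) (mono c)) (mono q) =
      (-1 : K) ^ ((weight b + weight c) * weight q) •
        nd (compLin d i f (mono q)) (mono b) (mono c) := by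
  induction hf using supp_induction with
  | zero => simp
  | add f g _ _ hf hg => simp only [map_add, LinearMap.add_apply, hf, hg, smul_add]
  | smul a f _ hf => simp only [map_smul, LinearMap.smul_apply, hf, smul_comm a]
  | mono p hp =>
    obtain rfl : arity p = n := hp
    simp only [nd_mono, compLin_mono, graft_of_le b c q hi, koszul_eq hd,
      nodesAfter_of_le b c hi, map_smul, LinearMap.smul_apply, smul_smul, ← pow_add]
    congr 2
    ring

theorem compLin_nd_left_of_le_add {d : ℤ} (hd : Odd d) {n : ℕ} {f : TreePoly K}
    (hf : f ∈ supp K {p | arity p = n}) (b c q : TTree) {i : ℕ} (hi : n < i)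
    (hi' : i ≤ n + arity b) :
    compLin d i (nd f (mono b) (mono c)) (mono q) =
      (-1 : K) ^ ((nodesAfter b (i - n) + weight c) * weight q) •
        nd f (mono (graft b (i - n) q)) (mono c) := by
  induction hf using supp_induction with
  | zero => simp
  | add f g _ _ hf hg => simp only [map_add, LinearMap.add_apply, hf, hg, smul_add]
  | smul a f _ hf => simp only [map_smul, LinearMap.smul_apply, hf, smul_comm a]
  | mono p hp =>
    obtain rfl : arity p = n := hp
    simp only [nd_mono, compLin_mono, graft_of_le_add c q hi hi', koszul_eq hd,
      nodesAfter_of_le_add c hi hi']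

theorem compLin_nd_left_of_lt {d : ℤ} (hd : Odd d) {n : ℕ} {f : TreePoly K}
    (hf : f ∈ supp K {p | arity p = n}) (b c q : TTree) {i : ℕ} (hi : n + arity b < i) :
    compLin d i (nd f (mono b) (mono c)) (mono q) =
      (-1 : K) ^ (nodesAfter c (i - n - arity b) * weight q) •
        nd f (mono b) (mono (graft c (i - n - arity b) q)) := by
  induction hf using supp_induction with
  | zero => simp
  | add f g _ _ hf hg => simp only [map_add, LinearMap.add_apply, hf, hg, smul_add]
  | smul a f _ hf => simp only [map_smul, LinearMap.smul_apply, hf, smul_comm a]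
  | mono p hp =>
    obtain rfl : arity p = n := hp
    simp only [nd_mono, compLin_mono, graft_of_lt c q hi, koszul_eq hd, nodesAfter_of_lt c hi]

theorem weight_of_arity {p : TTree} {n : ℕ} (h : arity p = n) : weight p = (n - 1) / 2 := by
  have := arity_eq p
  omega

theorem compLin_nd_middle {d : ℤ} (hd : Odd d) {n : ℕ} {f : TreePoly K}
    (hf : f ∈ supp K {p | arity p = n}) (a c q : TTree) (i : ℕ) :
    ∃ s : K, compLin d i (nd (mono a) f (mono c)) (mono q) =
      if i ≤ arity a then s • nd (mono (graft a i q)) f (mono c)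
      else if i ≤ arity a + n then s • nd (mono a) (compLin d (i - arity a) f (mono q)) (mono c)
      else s • nd (mono a) f (mono (graft c (i - arity a - n) q)) := by
  -- `(n - 1) / 2` is the common weight of the trees of arity `n`; the nodes of `f` come after leaf
  -- `i` when that leaf lies in `a`.
  refine ⟨if i ≤ arity a then (-1) ^ ((nodesAfter a i + (n - 1) / 2 + weight c) * weight q)
    else if i ≤ arity a + n then (-1) ^ (weight c * weight q)
    else (-1) ^ (nodesAfter c (i - arity a - n) * weight q), ?_⟩
  split_ifs with h1 h2
  all_goals
    induction hf using supp_induction with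
    | zero => simp
    | add f g _ _ hf hg => simp only [map_add, LinearMap.add_apply, hf, hg, smul_add]
    | smul a f _ hf => simp only [map_smul, LinearMap.smul_apply, hf, smul_comm a]
    | mono p hp => ?_
  all_goals
    have hw := weight_of_arity hp
    obtain rfl : arity p = n := hp
    simp only [nd_mono, compLin_mono, koszul_eq hd]
  · rw [graft_of_le p c q h1, nodesAfter_of_le p c h1, hw]
  · rw [graft_of_le_add c q (not_le.1 h1) h2, nodesAfter_of_le_add c (not_le.1 h1) h2]
    simp only [map_smul, LinearMap.smul_apply, nd_mono, smul_smul, ← pow_add]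
    congr 2
    ring
  · rw [graft_of_lt c q (not_le.1 h2), nodesAfter_of_lt c (not_le.1 h2)]

theorem compLin_nd_right {d : ℤ} (hd : Odd d) {n : ℕ} {f : TreePoly K}
    (hf : f ∈ supp K {p | arity p = n}) (a b q : TTree) (i : ℕ) :
    ∃ s : K, compLin d i (nd (mono a) (mono b) f) (mono q) =
      if i ≤ arity a then s • nd (mono (graft a i q)) (mono b) f
      else if i ≤ arity a + arity b then s • nd (mono a) (mono (graft b (i - arity a) q)) f
      else s • nd (mono a) (mono b) (compLin d (i - arity a - arity b) f (mono q)) := by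
  refine ⟨if i ≤ arity a then (-1) ^ ((nodesAfter a i + weight b + (n - 1) / 2) * weight q)
    else if i ≤ arity a + arity b
      then (-1) ^ ((nodesAfter b (i - arity a) + (n - 1) / 2) * weight q) else 1, ?_⟩
  split_ifs with h1 h2
  all_goals
    induction hf using supp_induction with
    | zero => simp
    | add f g _ _ hf hg => simp only [map_add, LinearMap.add_apply, hf, hg, smul_add]
    | smul a f _ hf => simp only [map_smul, LinearMap.smul_apply, hf, smul_comm a]
    | mono p hp => ?_
  all_goals
    have hw := weight_of_arity hp
    simp only [nd_mono, compLin_mono, koszul_eq hd]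
  · rw [graft_of_le b p q h1, nodesAfter_of_le b p h1, hw]
  · rw [graft_of_le_add p q (not_le.1 h1) h2, nodesAfter_of_le_add p (not_le.1 h1) h2, hw]
  · rw [graft_of_lt p q (not_le.1 h2), nodesAfter_of_lt p (not_le.1 h2)]
    simp only [map_smul, nd_mono, one_smul]

/-- Grafting a homogeneous element into a tree from the left. -/
theorem compLin_node {d : ℤ} (hd : Odd d) {n : ℕ} {f : TreePoly K}
    (hf : f ∈ supp K {p | arity p = n}) (a b c : TTree) (i : ℕ) :
    ∃ s : K, compLin d i (mono (node a b c)) f =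
      if i ≤ arity a then s • nd (compLin d i (mono a) f) (mono b) (mono c)
      else if i ≤ arity a + arity b
        then s • nd (mono a) (compLin d (i - arity a) (mono b) f) (mono c)
      else s • nd (mono a) (mono b) (compLin d (i - arity a - arity b) (mono c) f) := by
  -- Here `(n - 1) / 2` is the weight of the grafted element, which moves past the subtrees to the
  -- right of leaf `i`.
  refine ⟨if i ≤ arity a then (-1) ^ ((weight b + weight c) * ((n - 1) / 2))
    else if i ≤ arity a + arity b then (-1) ^ (weight c * ((n - 1) / 2)) else 1, ?_⟩
  split_ifs with h1 h2
  all_goals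
    induction hf using supp_induction with
    | zero => simp
    | add f g _ _ hf hg => simp only [map_add, LinearMap.add_apply, hf, hg, smul_add]
    | smul a f _ hf => simp only [map_smul, LinearMap.smul_apply, hf, smul_comm a]
    | mono p hp => ?_
  all_goals
    have hw := weight_of_arity hp
    simp only [compLin_mono, koszul_eq hd, map_smul, LinearMap.smul_apply, nd_mono, smul_smul,
      one_mul, ← pow_add]
  · rw [graft_of_le b c p h1, nodesAfter_of_le b c h1, hw]
    congr 2
    ring
  · rw [graft_of_le_add c p (not_le.1 h1) h2, nodesAfter_of_le_add c (not_le.1 h1) h2, hw]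
    congr 2
    ring
  · rw [graft_of_lt c p (not_le.1 h2), nodesAfter_of_lt c (not_le.1 h2)]

/-! ### The ideal generated by `α` -/

/-- The tree polynomial obtained from `α` by grafting trees into its five leaves. -/
def assocRel (e x y b c : TTree) : TreePoly K :=
  mono (node (node e x y) b c) + (-1 : K) ^ weight e • mono (node e (node x y b) c) +
    (-1 : K) ^ (weight e + weight x) • mono (node e x (node y b c))

/-- The relations `assocRel` inserted at an arbitrary place in a tree. -/
inductive Relation : TreePoly K → Prop
  | base (e x y b c : TTree) : Relation (assocRel e x y b c)
  | left (r : TreePoly K) (b c : TTree) : Relation r → Relation (nd r (mono b) (mono c))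
  | middle (a : TTree) (r : TreePoly K) (c : TTree) : Relation r → Relation (nd (mono a) r (mono c))
  | right (a b : TTree) (r : TreePoly K) : Relation r → Relation (nd (mono a) (mono b) r)

/-- The span of all relations. -/
def relSpan (K : Type*) [Field K] : Submodule K (TreePoly K) := Submodule.span K {r | Relation r}

theorem Relation.mem {r : TreePoly K} (h : Relation r) : r ∈ relSpan K := Submodule.subset_span h

theorem nd_left_mem {f : TreePoly K} (hf : f ∈ relSpan K) (b c : TTree) :
    nd f (mono b) (mono c) ∈ relSpan K := by
  induction hf using Submodule.span_induction with
  | mem r hr => exact (Relation.left _ b c hr).mem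
  | zero => simp
  | add f g _ _ hf hg =>
    simp only [map_add, LinearMap.add_apply]
    exact Submodule.add_mem _ hf hg
  | smul s f _ hf =>
    simp only [map_smul, LinearMap.smul_apply]
    exact Submodule.smul_mem _ _ hf

theorem nd_middle_mem {f : TreePoly K} (hf : f ∈ relSpan K) (a c : TTree) :
    nd (mono a) f (mono c) ∈ relSpan K := by
  induction hf using Submodule.span_induction with
  | mem r hr => exact (Relation.middle a _ c hr).mem
  | zero => simp
  | add f g _ _ hf hg =>
    simp only [map_add, LinearMap.add_apply]
    exact Submodule.add_mem _ hf hg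
  | smul s f _ hf =>
    simp only [map_smul, LinearMap.smul_apply]
    exact Submodule.smul_mem _ _ hf

theorem nd_right_mem {f : TreePoly K} (hf : f ∈ relSpan K) (a b : TTree) :
    nd (mono a) (mono b) f ∈ relSpan K := by
  induction hf using Submodule.span_induction with
  | mem r hr => exact (Relation.right a b _ hr).mem
  | zero => simp
  | add f g _ _ hf hg =>
    simp only [map_add]
    exact Submodule.add_mem _ hf hg
  | smul s f _ hf =>
    simp only [map_smul]
    exact Submodule.smul_mem _ _ hf

theorem nd_mem_supp {f g h : TreePoly K} {k m n : ℕ} (hf : f ∈ supp K {p | arity p = k})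
    (hg : g ∈ supp K {p | arity p = m}) (hh : h ∈ supp K {p | arity p = n}) :
    nd f g h ∈ supp K {p | arity p = k + m + n} := by
  refine trilin_mem _ hf hg hh ?_
  rintro a rfl b rfl c rfl
  exact mono_mem_supp rfl

theorem mono_mem_supp_arity (p : TTree) : (mono p : TreePoly K) ∈ supp K {q | arity q = arity p} :=
  mono_mem_supp rfl

theorem Relation.exists_arity {r : TreePoly K} (h : Relation r) :
    ∃ n, r ∈ supp K {p | arity p = n} := by
  induction h with
  | base e x y b c =>
    refine ⟨arity e + arity x + arity y + arity b + arity c, ?_⟩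
    refine Submodule.add_mem _ (Submodule.add_mem _ ?_ (Submodule.smul_mem _ _ ?_))
      (Submodule.smul_mem _ _ ?_) <;>
    refine mono_mem_supp ?_ <;> simp only [Set.mem_ofPred_eq, arity] <;> omega
  | left r b c _ ih =>
    obtain ⟨n, hn⟩ := ih
    exact ⟨_, nd_mem_supp hn (mono_mem_supp_arity b) (mono_mem_supp_arity c)⟩
  | middle a r c _ ih =>
    obtain ⟨n, hn⟩ := ih
    exact ⟨_, nd_mem_supp (mono_mem_supp_arity a) hn (mono_mem_supp_arity c)⟩
  | right a b r _ ih =>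
    obtain ⟨n, hn⟩ := ih
    exact ⟨_, nd_mem_supp (mono_mem_supp_arity a) (mono_mem_supp_arity b) hn⟩

set_option linter.unusedSimpArgs false in
-- Leaf `i` lies in one of the five subtrees, and grafting there gives the relation with that
-- subtree enlarged. The scalar is the sign of the first term. When the inner node of another term
-- comes after leaf `i`, the additional sign is the one produced by the larger weight of `e` or `x`
-- in the new relation.
theorem compLin_assocRel_mem {d : ℤ} (hd : Odd d) (e x y b c q : TTree) (i : ℕ) :
    compLin d i (assocRel e x y b c) (mono q) ∈ relSpan K := by
  suffices ∃ (s : K) (e' x' y' b' c' : TTree),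
      compLin d i (assocRel e x y b c) (mono q) = s • assocRel e' x' y' b' c' by
    obtain ⟨s, e', x', y', b', c', h⟩ := this
    rw [h]
    exact Submodule.smul_mem _ _ (Relation.base ..).mem
  simp only [assocRel, map_add, map_smul, LinearMap.add_apply, LinearMap.smul_apply, compLin_mono,
    koszul_eq hd]
  rcases le_or_gt i (arity e) with h | h1
  · refine ⟨(-1) ^ ((nodesAfter e i + weight x + weight y + weight b + weight c) * weight q),
      graft e i q, x, y, b, c, ?_⟩
    simp (disch := (try simp only [arity]); omega) only [graft_of_le, graft_of_le_add, graft_of_lt,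
      nodesAfter_of_le, nodesAfter_of_le_add, nodesAfter_of_lt, weight, weight_graft, smul_add,
      smul_smul, arity, Nat.sub_sub]
    refine congrArg₂ (· + ·) (congrArg₂ (· + ·) ?_ ?_) ?_ <;> congr 1 <;> ring
  rcases le_or_gt i (arity e + arity x) with h | h2
  · refine ⟨(-1) ^ ((nodesAfter x (i - arity e) + weight y + weight b + weight c) * weight q),
      e, graft x (i - arity e) q, y, b, c, ?_⟩
    simp (disch := (try simp only [arity]); omega) only [graft_of_le, graft_of_le_add, graft_of_lt,
      nodesAfter_of_le, nodesAfter_of_le_add, nodesAfter_of_lt, weight, weight_graft, smul_add,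
      smul_smul, arity, Nat.sub_sub]
    refine congrArg₂ (· + ·) (congrArg₂ (· + ·) ?_ ?_) ?_ <;> congr 1 <;> ring
  rcases le_or_gt i (arity e + arity x + arity y) with h | h3
  · refine ⟨(-1) ^ ((nodesAfter y (i - (arity e + arity x)) + weight b + weight c) * weight q),
      e, x, graft y (i - (arity e + arity x)) q, b, c, ?_⟩
    simp (disch := (try simp only [arity]); omega) only [graft_of_le, graft_of_le_add, graft_of_lt,
      nodesAfter_of_le, nodesAfter_of_le_add, nodesAfter_of_lt, weight, weight_graft, smul_add,
      smul_smul, arity, Nat.sub_sub]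
    refine congrArg₂ (· + ·) (congrArg₂ (· + ·) ?_ ?_) ?_ <;> congr 1 <;> ring
  rcases le_or_gt i (arity e + arity x + arity y + arity b) with h | h4
  · refine ⟨(-1) ^ ((nodesAfter b (i - (arity e + arity x + arity y)) + weight c) * weight q),
      e, x, y, graft b (i - (arity e + arity x + arity y)) q, c, ?_⟩
    simp (disch := (try simp only [arity]); omega) only [graft_of_le, graft_of_le_add, graft_of_lt,
      nodesAfter_of_le, nodesAfter_of_le_add, nodesAfter_of_lt, weight, weight_graft, smul_add,
      smul_smul, arity, Nat.sub_sub]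
    refine congrArg₂ (· + ·) (congrArg₂ (· + ·) ?_ ?_) ?_ <;> congr 1 <;> ring
  · refine ⟨(-1) ^ (nodesAfter c (i - (arity e + arity x + arity y + arity b)) * weight q),
      e, x, y, b, graft c (i - (arity e + arity x + arity y + arity b)) q, ?_⟩
    simp (disch := (try simp only [arity]); omega) only [graft_of_lt, nodesAfter_of_lt, weight,
      smul_add, smul_smul, arity, Nat.sub_sub, ← Nat.add_assoc]
    refine congrArg₂ (· + ·) (congrArg₂ (· + ·) ?_ ?_) ?_ <;> congr 1 <;> ring

theorem Relation.compLin_left_mem {d : ℤ} (hd : Odd d) {r : TreePoly K} (h : Relation r) (q : TTree)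
    (i : ℕ) : compLin d i r (mono q) ∈ relSpan K := by
  induction h generalizing i with
  | base e x y b c => exact compLin_assocRel_mem hd e x y b c q i
  | left r b c hr ih =>
    obtain ⟨n, hn⟩ := hr.exists_arity
    rcases le_or_gt i n with h1 | h1
    · rw [compLin_nd_left hd hn b c q h1]
      exact Submodule.smul_mem _ _ (nd_left_mem (ih i) b c)
    rcases le_or_gt i (n + arity b) with h2 | h2
    · rw [compLin_nd_left_of_le_add hd hn b c q h1 h2]
      exact Submodule.smul_mem _ _ (nd_left_mem hr.mem _ _)
    · rw [compLin_nd_left_of_lt hd hn b c q h2]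
      exact Submodule.smul_mem _ _ (nd_left_mem hr.mem _ _)
  | middle a r c hr ih =>
    obtain ⟨n, hn⟩ := hr.exists_arity
    obtain ⟨s, hs⟩ := compLin_nd_middle hd hn a c q i
    rw [hs]
    split_ifs
    · exact Submodule.smul_mem _ _ (nd_middle_mem hr.mem _ _)
    · exact Submodule.smul_mem _ _ (nd_middle_mem (ih _) _ _)
    · exact Submodule.smul_mem _ _ (nd_middle_mem hr.mem _ _)
  | right a b r hr ih =>
    obtain ⟨n, hn⟩ := hr.exists_arity
    obtain ⟨s, hs⟩ := compLin_nd_right hd hn a b q i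
    rw [hs]
    split_ifs
    · exact Submodule.smul_mem _ _ (nd_right_mem hr.mem _ _)
    · exact Submodule.smul_mem _ _ (nd_right_mem hr.mem _ _)
    · exact Submodule.smul_mem _ _ (nd_right_mem (ih _) _ _)

theorem compLin_leaf (d : ℤ) (i : ℕ) (f : TreePoly K) : compLin d i (mono leaf) f = f := by
  induction f using mono_induction with
  | zero => simp
  | add f g hf hg => simp only [map_add, hf, hg]
  | smul a f hf => simp only [map_smul, hf]
  | mono p => simp [koszul, nodesAfter, graft]

theorem Relation.compLin_right_mem {d : ℤ} (hd : Odd d) {r : TreePoly K} (h : Relation r)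
    (p : TTree) (i : ℕ) : compLin d i (mono p) r ∈ relSpan K := by
  obtain ⟨n, hn⟩ := h.exists_arity
  induction p generalizing i with
  | leaf => rw [compLin_leaf]; exact h.mem
  | node a b c iha ihb ihc =>
    obtain ⟨s, hs⟩ := compLin_node hd hn a b c i
    rw [hs]
    split_ifs
    · exact Submodule.smul_mem _ _ (nd_left_mem (iha _) _ _)
    · exact Submodule.smul_mem _ _ (nd_middle_mem (ihb _) _ _)
    · exact Submodule.smul_mem _ _ (nd_right_mem (ihc _) _ _)

theorem compLin_left_mem {d : ℤ} (hd : Odd d) {f : TreePoly K} (hf : f ∈ relSpan K)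
    (g : TreePoly K) (i : ℕ) : compLin d i f g ∈ relSpan K := by
  induction g using mono_induction with
  | zero => simp
  | add g h hg hh => rw [map_add]; exact Submodule.add_mem _ hg hh
  | smul a g hg => rw [map_smul]; exact Submodule.smul_mem _ _ hg
  | mono q =>
  induction hf using Submodule.span_induction with
  | mem r hr => exact Relation.compLin_left_mem hd hr q i
  | zero => simp
  | add f g _ _ hf hg => rw [map_add, LinearMap.add_apply]; exact Submodule.add_mem _ hf hg
  | smul s f _ hf => rw [map_smul, LinearMap.smul_apply]; exact Submodule.smul_mem _ _ hf

theorem compLin_right_mem {d : ℤ} (hd : Odd d) {f : TreePoly K} (hf : f ∈ relSpan K)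
    (g : TreePoly K) (i : ℕ) : compLin d i g f ∈ relSpan K := by
  induction g using mono_induction with
  | zero => simp
  | add g h hg hh => rw [map_add, LinearMap.add_apply]; exact Submodule.add_mem _ hg hh
  | smul a g hg => rw [map_smul, LinearMap.smul_apply]; exact Submodule.smul_mem _ _ hg
  | mono q =>
  induction hf using Submodule.span_induction with
  | mem r hr => exact Relation.compLin_right_mem hd hr q i
  | zero => simp
  | add f g _ _ hf hg => rw [map_add]; exact Submodule.add_mem _ hf hg
  | smul s f _ hf => rw [map_smul]; exact Submodule.smul_mem _ _ hf

theorem isOperadIdeal_relSpan {d : ℤ} (hd : Odd d) : IsOperadIdeal d (relSpan K) where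
  homogeneous := by
    intro f hf n
    induction hf using Submodule.span_induction with
    | mem r hr =>
      obtain ⟨m, hm⟩ := Relation.exists_arity hr
      rw [← isHomog_iff] at hm
      by_cases h : m = n
      · rw [Finsupp.filter_eq_self_iff _ _ |>.2 fun p hp => ?_]
        · exact Relation.mem hr
        · rw [hm p (Finsupp.mem_support_iff.2 hp), h]
      · rw [Finsupp.filter_eq_zero_iff _ _ |>.2 fun p hp => ?_]
        · exact Submodule.zero_mem _
        · by_contra h'
          exact h ((hm p (Finsupp.mem_support_iff.2 h')).symm.trans hp)
    | zero => rw [Finsupp.filter_zero]; exact Submodule.zero_mem _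
    | add f g _ _ hf hg => rw [Finsupp.filter_add]; exact Submodule.add_mem _ hf hg
    | smul a f _ hf => rw [Finsupp.filter_smul]; exact Submodule.smul_mem _ _ hf
  comp_right _ _ f g i hf _ _ _ _ := by
    rw [comp_eq_compLin]
    exact compLin_left_mem hd hf g i
  comp_left _ _ f g i hf _ _ _ _ := by
    rw [comp_eq_compLin]
    exact compLin_right_mem hd hf g i

/-! ### The ideal of `α` lies in the span of the relations, and hence in the kernel of `nfLin`. -/

theorem koszul_eq_one {d : ℤ} {p q : TTree} {i : ℕ} (h : nodesAfter p i = 0) :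
    (koszul d p i q : K) = 1 := by
  simp [koszul, h]

theorem alpha_eq (d : ℤ) : (alpha d : TreePoly K) =
    mono (node t leaf leaf) + mono (node leaf t leaf) + mono (node leaf leaf t) := by
  have h (i : ℕ) : nodesAfter t i = 0 := by simp [t, nodesAfter, weight]
  simp only [alpha, comp_eq_compLin, compLin_mono, koszul_eq_one (h _), one_smul]
  rfl

theorem alpha_eq_assocRel (d : ℤ) :
    (alpha d : TreePoly K) = assocRel leaf leaf leaf leaf leaf := by
  simp [alpha_eq, assocRel, weight, t]

theorem idealSpan_le_relSpan {d : ℤ} (hd : Odd d) :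
    idealSpan d {(alpha d : TreePoly K)} ≤ relSpan K := by
  refine sInf_le ⟨isOperadIdeal_relSpan hd, ?_⟩
  rw [Set.singleton_subset_iff, alpha_eq_assocRel]
  exact (Relation.base ..).mem

theorem isOperadIdeal_idealSpan (d : ℤ) (G : Set (TreePoly K)) :
    IsOperadIdeal d (idealSpan d G) where
  homogeneous f hf n := by
    rw [idealSpan, Submodule.mem_sInf] at hf ⊢
    exact fun S hS => hS.1.homogeneous f (hf S hS) n
  comp_right m n f g i hf h1 h2 h3 h4 := by
    rw [idealSpan, Submodule.mem_sInf] at hf ⊢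
    exact fun S hS => hS.1.comp_right m n f g i (hf S hS) h1 h2 h3 h4
  comp_left m n f g i hf h1 h2 h3 h4 := by
    rw [idealSpan, Submodule.mem_sInf] at hf ⊢
    exact fun S hS => hS.1.comp_left m n f g i (hf S hS) h1 h2 h3 h4

theorem subset_idealSpan (d : ℤ) (G : Set (TreePoly K)) : G ⊆ idealSpan d G := by
  intro g hg
  rw [SetLike.mem_coe, idealSpan, Submodule.mem_sInf]
  exact fun S hS => hS.2 hg

/-- Partial associativity of `muLin` applied to the normal forms of the five subtrees. -/
theorem nfLin_assocRel (e x y b c : TTree) : nfLin (assocRel e x y b c : TreePoly K) = 0 := by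
  have h := muLin_assoc (nf e : TreePoly K) (nf x) (nf y) (nf b) (nf c)
  simp only [sgn_nf, map_smul, LinearMap.smul_apply, smul_smul] at h
  simpa only [assocRel, map_add, map_smul, nfLin_mono, nf, pow_add, mul_comm] using h

theorem nfLin_eq_zero {f : TreePoly K} (hf : f ∈ relSpan K) : nfLin f = 0 := by
  suffices relSpan K ≤ LinearMap.ker nfLin from this hf
  refine Submodule.span_le.2 fun r hr => ?_
  rw [SetLike.mem_coe, LinearMap.mem_ker]
  induction hr with
  | base => exact nfLin_assocRel ..
  | left r b c _ ih => rw [nfLin_nd, ih]; simp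
  | middle a r c _ ih => rw [nfLin_nd, ih]; simp
  | right a b r _ ih => rw [nfLin_nd, ih]; simp

/-! ### Leading monomials -/

theorem exists_isLM {f : TreePoly K} (hf : f ≠ 0) {n : ℕ} (hn : IsHomog n f) : ∃ p, IsLM f p := by
  obtain ⟨p, hp, hmax⟩ := f.support.exists_max_image path (Finsupp.support_nonempty_iff.2 hf)
  refine ⟨p, hp, fun q hq => ⟨(hn q hq).trans (hn p hp).symm, ?_⟩⟩
  exact (hmax q hq).eq_or_lt.imp (fun h => path_injective h) id

/-- The coefficient of `p` in `nfLin f` is `f p`: the tree `p` is its own normal form, and every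
other monomial of `f` is smaller and has a normal form made of trees below `p`. But `nfLin f = 0`.
-/
theorem not_leftLeaf_of_isLM {f : TreePoly K} (hf : f ∈ relSpan K) {p : TTree} (hp : IsLM f p) :
    ¬LeftLeaf p := by
  intro h
  have h0 := nfLin_eq_zero hf
  have : (nfLin f) p = f p := by
    rw [nfLin, Finsupp.linearCombination_apply, Finsupp.sum, Finsupp.finsetSum_apply,
      Finset.sum_eq_single p]
    · simp [nf_of_leftLeaf h, mono]
    · intro q hq hqp
      have hlt := ((hp.2 q hq).2.resolve_left hqp)
      suffices (nf q : TreePoly K) p = 0 by simp [this]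
      by_contra h'
      rcases (Finsupp.mem_supported K _).1 (nf_mem_supp (K := K) q)
        (Finsupp.mem_support_iff.2 h') with rfl | h''
      · exact hqp rfl
      · exact lt_asymm hlt h''.2
    · intro h'
      exact absurd hp.1 h'
  rw [h0] at this
  exact Finsupp.mem_support_iff.1 hp.1 this.symm

/-! ### The partial composition rules -/

theorem neg_one_pow_mul_self (n : ℕ) : (-1 : K) ^ n * (-1 : K) ^ n = 1 := by
  rw [← mul_pow]; simp

theorem comp_comp_of_mem {d : ℤ} (hd : Odd d) (p q r : TTree) (i j : ℕ) (hi : 1 ≤ i)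
    (hip : i ≤ arity p) (hij : i ≤ j) (hj : j ≤ i + arity q - 1) :
    comp d (comp d (mono p : TreePoly K) i (mono q)) j (mono r) =
      comp d (mono p) i (comp d (mono q) (j - i + 1) (mono r)) := by
  obtain ⟨h1, h2⟩ := graft_graft_of_mem p q r i j hi hip hij hj
  simp only [comp_eq_compLin, compLin_mono, map_smul, LinearMap.smul_apply, smul_smul,
    koszul_eq hd, h1, h2, weight_graft]
  congr 1
  ring

theorem comp_comp_of_lt {d : ℤ} (hd : Odd d) (p q r : TTree) (i j : ℕ) (hi : 1 ≤ i)
    (hij : i + arity q ≤ j) (hj : j ≤ arity p + arity q - 1) :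
    comp d (comp d (mono p : TreePoly K) i (mono q)) j (mono r) =
      (-1 : K) ^ (weight q * weight r) •
        comp d (comp d (mono p) (j - arity q + 1) (mono r)) i (mono q) := by
  have hq := arity_pos q
  obtain ⟨h1, h2, h3⟩ := graft_graft_of_lt p q r i (j - arity q + 1) hi (by omega) (by omega)
  rw [show j - arity q + 1 + arity q - 1 = j by omega] at h1 h2
  simp only [comp_eq_compLin, compLin_mono, map_smul, LinearMap.smul_apply, smul_smul,
    koszul_eq hd, h1, h2, h3]
  congr 1
  rw [add_mul, pow_add, mul_comm (weight r) (weight q)]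
  -- The interchange sign occurs twice on the right, once as the stated factor and once because `r`
  -- lies after leaf `i`; its square is 1.
  linear_combination (-(-1 : K) ^ (nodesAfter p i * weight q) *
    (-1) ^ (nodesAfter p (j - arity q + 1) * weight r)) *
      neg_one_pow_mul_self (K := K) (weight q * weight r)

theorem comp_comp_of_gt {d : ℤ} (hd : Odd d) (p q r : TTree) (i j : ℕ) (hip : i ≤ arity p)
    (hj : 1 ≤ j) (hij : j ≤ i - 1) :
    comp d (comp d (mono p : TreePoly K) i (mono q)) j (mono r) =
      (-1 : K) ^ (weight q * weight r) •
        comp d (comp d (mono p) j (mono r)) (i + arity r - 1) (mono q) := by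
  obtain ⟨h1, h2, h3⟩ := graft_graft_of_lt p r q j i hj (by omega) hip
  simp only [comp_eq_compLin, compLin_mono, map_smul, LinearMap.smul_apply, smul_smul,
    koszul_eq hd, h1, h2, h3]
  congr 1
  ring

/-! ### Contexts -/

theorem compLin_leaf_right (d : ℤ) (i : ℕ) (f : TreePoly K) : compLin d i f (mono leaf) = f := by
  induction f using mono_induction with
  | zero => simp
  | add f g hf hg => simp only [map_add, LinearMap.add_apply, hf, hg]
  | smul a f hf => simp only [map_smul, LinearMap.smul_apply, hf]
  | mono p => simp [koszul, weight, graft_leaf]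

theorem compLin_mem_supp {d : ℤ} {i m n k : ℕ} {f g : TreePoly K}
    (hf : f ∈ supp K {p | arity p = m}) (hg : g ∈ supp K {p | arity p = n}) (hk : k + 1 = m + n) :
    compLin d i f g ∈ supp K {p | arity p = k} := by
  induction hf using supp_induction with
  | zero => simp
  | add f g _ _ hf hg => rw [map_add, LinearMap.add_apply]; exact Submodule.add_mem _ hf hg
  | smul s f _ hf => rw [map_smul, LinearMap.smul_apply]; exact Submodule.smul_mem _ _ hf
  | mono p hp =>
  refine map_mem_of_mem_supp hg _ fun q hq => ?_
  rw [compLin_mono]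
  refine Submodule.smul_mem _ _ (mono_mem_supp ?_)
  have := arity_graft p i q
  simp only [Set.mem_ofPred_eq] at hp hq ⊢
  omega

namespace Ctx

theorem apply_add (d : ℤ) (C : Ctx) (f g : TreePoly K) :
    C.apply d (f + g) = C.apply d f + C.apply d g := by
  induction C with
  | hole => rfl
  | after C i r ih => simp only [apply, ih, comp_eq_compLin, map_add, LinearMap.add_apply]
  | into r i C ih => simp only [apply, ih, comp_eq_compLin, map_add]

theorem apply_mono (d : ℤ) (C : Ctx) (p : TTree) :
    C.apply d (mono p : TreePoly K) = (C.sign d p : K) • mono (C.plug p) := by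
  induction C with
  | hole => simp [apply, sign, plug]
  | after C i r ih =>
    simp only [apply, ih, comp_eq_compLin, map_smul, LinearMap.smul_apply, compLin_mono, smul_smul,
      sign, plug]
  | into r i C ih =>
    simp only [apply, ih, comp_eq_compLin, map_smul, compLin_mono, smul_smul, sign, plug]

/-- Makes the normalisation in `M` correct: the sign of the context is its own inverse. -/
theorem sign_mul_self {d : ℤ} (hd : Odd d) (C : Ctx) (p : TTree) :
    (C.sign d p : K) * C.sign d p = 1 := by
  induction C with
  | hole => simp [sign]
  | after C i r ih =>
    rw [sign, mul_mul_mul_comm, ih, koszul_eq hd, neg_one_pow_mul_self, one_mul]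
  | into r i C ih =>
    rw [sign, mul_mul_mul_comm, ih, koszul_eq hd, neg_one_pow_mul_self, one_mul]

theorem weight_le_plug (C : Ctx) (p : TTree) : weight p ≤ weight (C.plug p) := by
  induction C with
  | hole => exact le_rfl
  | after C i r ih => rw [plug, weight_graft]; omega
  | into r i C ih => rw [plug, weight_graft]; omega

theorem apply_mem {d : ℤ} {S : Submodule K (TreePoly K)} (hS : IsOperadIdeal d S) {C : Ctx}
    {p : TTree} (hC : C.Valid p) {f : TreePoly K} (hf : f ∈ S) (hp : IsHomog (arity p) f) :
    C.apply d f ∈ S ∧ IsHomog (arity (C.plug p)) (C.apply d f) := by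
  induction C with
  | hole => exact ⟨hf, hp⟩
  | after C i r ih =>
    obtain ⟨hC, hi, hi'⟩ := hC
    obtain ⟨h1, h2⟩ := ih hC
    refine ⟨hS.comp_right _ _ _ _ i h1 h2 (isHomog_iff.2 (mono_mem_supp_arity r)) hi hi', ?_⟩
    rw [apply, comp_eq_compLin, isHomog_iff]
    exact compLin_mem_supp (isHomog_iff.1 h2) (mono_mem_supp_arity r) (arity_graft _ _ _)
  | into r i C ih =>
    obtain ⟨hC, hi, hi'⟩ := hC
    obtain ⟨h1, h2⟩ := ih hC
    refine ⟨hS.comp_left _ _ _ _ i h1 h2 (isHomog_iff.2 (mono_mem_supp_arity r)) hi hi', ?_⟩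
    rw [apply, comp_eq_compLin, isHomog_iff]
    exact compLin_mem_supp (mono_mem_supp_arity r) (isHomog_iff.1 h2) (arity_graft _ _ _)

/-- A context that adds no internal node is trivial. -/
theorem eq_hole_of_weight (K : Type*) [Field K] (d : ℤ) {C : Ctx} {p : TTree}
    (h : weight (C.plug p) = weight p) :
    C.pos = [] ∧ C.plug p = p ∧ (C.sign d p : K) = 1 ∧
      ∀ f : TreePoly K, C.apply d f = f := by
  induction C with
  | hole => exact ⟨rfl, rfl, rfl, fun _ => rfl⟩
  | after C i r ih =>
    have := C.weight_le_plug p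
    rw [plug, weight_graft] at h
    obtain ⟨h1, h2, h3, h4⟩ := ih (by omega)
    obtain rfl : r = leaf := eq_leaf_of_weight_eq_zero (by omega)
    refine ⟨h1, by rw [plug, graft_leaf, h2], ?_, fun f => ?_⟩
    · simp [sign, h3, koszul, weight]
    · rw [apply, h4, comp_eq_compLin, compLin_leaf_right]
  | into r i C ih =>
    have := C.weight_le_plug p
    rw [plug, weight_graft] at h
    obtain ⟨h1, h2, h3, h4⟩ := ih (by omega)
    obtain rfl : r = leaf := eq_leaf_of_weight_eq_zero (by omega)
    refine ⟨by rw [pos, h1]; rfl, by rw [plug, h2]; rfl, ?_, fun f => ?_⟩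
    · simp [sign, h3, koszul, nodesAfter]
    · rw [apply, h4, comp_eq_compLin, compLin_leaf]

/-- A context that adds one internal node acts as `(⋯) ∘ᵢ t` or as `t ∘ᵢ (⋯)`. -/
theorem eq_of_weight_add_one (K : Type*) [Field K] (d : ℤ) {C : Ctx} {p : TTree} (hC : C.Valid p)
    (h : weight (C.plug p) = weight p + 1) :
    (∃ i, 1 ≤ i ∧ i ≤ arity p ∧ C.pos = [] ∧ C.plug p = graft p i t ∧
        (C.sign d p : K) = koszul d p i t ∧
        ∀ f : TreePoly K, C.apply d f = comp d f i (mono t)) ∨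
      ∃ i, 1 ≤ i ∧ i ≤ arity t ∧ C.pos = leafAddr t i ∧ C.plug p = graft t i p ∧
        (C.sign d p : K) = koszul d t i p ∧
        ∀ f : TreePoly K, C.apply d f = comp d (mono t) i f := by
  induction C with
  | hole => simp [plug] at h
  | after C i r ih =>
    have := C.weight_le_plug p
    obtain ⟨hC, hi, hi'⟩ := hC
    rw [plug, weight_graft] at h
    -- Exactly one grafted tree contributes a node. Either `r` is a leaf and grafting it changes
    -- nothing, or `r` is `t` and the rest of the context is trivial.
    rcases Nat.eq_zero_or_pos (weight r) with hr | hr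
    · obtain rfl := eq_leaf_of_weight_eq_zero hr
      simpa [pos, plug, graft_leaf, sign, koszul, hr, apply, comp_eq_compLin, compLin_leaf_right]
        using ih hC (by omega)
    · obtain rfl : r = t := eq_t_of_weight_eq_one (by omega)
      obtain ⟨h1, h2, h3, h4⟩ := eq_hole_of_weight K d (C := C) (p := p) (by omega)
      rw [h2] at hi'
      exact Or.inl ⟨i, hi, hi', h1, by rw [plug, h2], by rw [sign, h3, h2, one_mul],
        fun f => by rw [apply, h4]⟩
  | into r i C ih =>
    have := C.weight_le_plug p
    obtain ⟨hC, hi, hi'⟩ := hC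
    rw [plug, weight_graft] at h
    rcases Nat.eq_zero_or_pos (weight r) with hr | hr
    · obtain rfl := eq_leaf_of_weight_eq_zero hr
      simpa [pos, plug, graft, leafAddr, sign, koszul, nodesAfter, apply, comp_eq_compLin,
        compLin_leaf] using ih hC (by omega)
    · obtain rfl : r = t := eq_t_of_weight_eq_one (by omega)
      obtain ⟨h1, h2, h3, h4⟩ := eq_hole_of_weight K d (C := C) (p := p) (by omega)
      exact Or.inr ⟨i, hi, hi', by rw [pos, h1, List.append_nil], by rw [plug, h2],
        by rw [sign, h3, h2, one_mul], fun f => by rw [apply, h4]⟩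

end Ctx

/-! ### Reductions by `α` -/

theorem isLM_alpha (d : ℤ) : IsLM (alpha d : TreePoly K) (graft t 1 t) ∧
    (alpha d : TreePoly K) (graft t 1 t) = 1 := by
  have h1 : (alpha d : TreePoly K) (graft t 1 t) = 1 := by
    rw [alpha_eq]
    simp [mono, t, graft, arity]
  refine ⟨⟨Finsupp.mem_support_iff.2 (by rw [h1]; exact one_ne_zero), fun q hq => ?_⟩, h1⟩
  have : (alpha d : TreePoly K) ∈ supp K {q | AtMost q (graft t 1 t)} := by
    rw [alpha_eq]
    refine Submodule.add_mem _ (Submodule.add_mem _ ?_ ?_) ?_ <;> refine mono_mem_supp ?_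
    · exact Or.inl rfl
    · exact Or.inr (smaller_of_left_assoc _ _ _ _ _ _ _ rfl)
    · exact Or.inr (smaller_of_left_assoc _ _ _ _ _ _ _ rfl)
  rcases (Finsupp.mem_supported K _).1 this hq with h | h
  · exact ⟨congrArg arity h, Or.inl h⟩
  · exact ⟨h.1, Or.inr h.2⟩

theorem isHomog_alpha (d : ℤ) : IsHomog (arity (graft t 1 t)) (alpha d : TreePoly K) :=
  fun q hq => ((isLM_alpha d).1.2 q hq).1

/-- A tree that is not in normal form is divisible by `t ∘₁ t`, and rewriting this copy
of `t ∘₁ t` by `α = 0` yields smaller trees. -/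
theorem exists_ctx_of_not_leftLeaf {q : TTree} (h : ¬LeftLeaf q) :
    ∃ C : Ctx, C.Valid (graft t 1 t) ∧ C.plug (graft t 1 t) = q ∧
      Smaller (C.plug (node leaf t leaf)) q ∧ Smaller (C.plug (node leaf leaf t)) q := by
  induction q with
  | leaf => exact absurd trivial h
  | node a b c _ ihb ihc =>
    -- There is no need to search inside `a`: if `b` and `c` are irreducible, then `a` is not a leaf
    -- and `t ∘₁ t` occurs at the root.
    by_cases hb : LeftLeaf b
    · by_cases hc : LeftLeaf c
      · cases a with
        | leaf => exact absurd ⟨rfl, hb, hc⟩ h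
        | node e x y =>
          -- The five subtrees are grafted from right to left, so the indices of the leaves still to
          -- be filled do not shift.
          refine ⟨.after (.after (.after (.after (.after .hole 5 c) 4 b) 3 y) 2 x) 1 e, ?_⟩
          simp only [Ctx.Valid, Ctx.plug]
          refine ⟨?_, ?_, ?_, ?_⟩
          · simp [t, graft, arity]
            omega
          · simp [t, graft, arity]
          · rw [show (((((node leaf t leaf).graft 5 c).graft 4 b).graft 3 y).graft 2 x).graft 1 e =
              node e (node x y b) c by
              simp [t, graft, arity, show 3 ≤ 1 + (2 + arity b) by omega,
                show 2 ≤ 1 + (1 + arity y + arity b) by omega]]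
            exact smaller_of_left_assoc e x y b c (node x y b) c (by simp only [arity])
          · rw [show (((((node leaf leaf t).graft 5 c).graft 4 b).graft 3 y).graft 2 x).graft 1 e =
              node e x (node y b c) by simp [t, graft, arity]]
            exact smaller_of_left_assoc e x y b c x (node y b c) (by simp only [arity]; omega)
      · obtain ⟨C, h1, h2, h3, h4⟩ := ihc hc
        have key (z : TTree) : graft (node a b leaf) (arity a + arity b + 1) z = node a b z := by
          rw [graft_of_lt _ _ (by omega)]; rfl
        refine ⟨.into (node a b leaf) (arity a + arity b + 1) C, ⟨h1, by omega, ?_⟩, ?_, ?_, ?_⟩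
        · simp [arity]
        · rw [Ctx.plug, key, h2]
        · rw [Ctx.plug, key]; exact h3.right _ _
        · rw [Ctx.plug, key]; exact h4.right _ _
    · obtain ⟨C, h1, h2, h3, h4⟩ := ihb hb
      have key (z : TTree) : graft (node a leaf c) (arity a + 1) z = node a z c := by
        rw [graft_of_le_add _ _ (by omega) (by simp [arity])]; rfl
      refine ⟨.into (node a leaf c) (arity a + 1) C, ⟨h1, by omega, ?_⟩, ?_, ?_, ?_⟩
      · simp [arity]
      · rw [Ctx.plug, key, h2]
      · rw [Ctx.plug, key]; exact h3.middle _ _ _ rfl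
      · rw [Ctx.plug, key]; exact h4.middle _ _ _ rfl

/-! ### The Gröbner property and reduction to zero. -/

theorem isGroebnerBasis_alpha {d : ℤ} (hd : Odd d) :
    IsGroebnerBasis d {(alpha d : TreePoly K)} (idealSpan d {alpha d}) where
  finite := Set.finite_singleton _
  relations := by
    rintro _ rfl
    refine ⟨fun h => ?_, _, isHomog_alpha d⟩
    have := (isLM_alpha (K := K) d).2
    rw [h] at this
    exact zero_ne_one this
  ideal_eq := rfl
  divides f hf h0 n hn := by
    obtain ⟨q, hq⟩ := exists_isLM h0 hn
    obtain ⟨C, hC, hCq, -⟩ := exists_ctx_of_not_leftLeaf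
      (not_leftLeaf_of_isLM (idealSpan_le_relSpan hd hf) hq)
    exact ⟨_, rfl, _, q, (isLM_alpha d).1, hq, C, hC, hCq⟩

theorem M_alpha_mem {d : ℤ} {C : Ctx} (hC : C.Valid (graft t 1 t)) :
    M d C (graft t 1 t) (alpha d : TreePoly K) ∈ idealSpan d {(alpha d : TreePoly K)} ∧
      IsHomog (arity (C.plug (graft t 1 t))) (M d C (graft t 1 t) (alpha d : TreePoly K)) := by
  obtain ⟨h1, h2⟩ := Ctx.apply_mem (isOperadIdeal_idealSpan d {(alpha d : TreePoly K)}) hC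
    (subset_idealSpan d _ rfl) (isHomog_alpha d)
  exact ⟨Submodule.smul_mem _ _ h1,
    isHomog_iff.2 (Submodule.smul_mem _ _ (isHomog_iff.1 h2))⟩

/-- The context sign occurs once in `M` and once in the evaluation at `t ∘₁ t`, so `q` has
coefficient 1 and a reduction removes the leading term exactly. -/
theorem M_alpha_sub_mem {d : ℤ} (hd : Odd d) {C : Ctx} {q : TTree}
    (h : C.plug (graft t 1 t) = q) (h2 : Smaller (C.plug (node leaf t leaf)) q)
    (h3 : Smaller (C.plug (node leaf leaf t)) q) :
    M d C (graft t 1 t) (alpha d : TreePoly K) - mono q ∈ supp K {p | Smaller p q} := by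
  have h' : C.plug (node t leaf leaf) = q := h
  have hs := C.sign_mul_self (K := K) hd (node t leaf leaf)
  rw [M, alpha_eq, Ctx.apply_add, Ctx.apply_add, Ctx.apply_mono, Ctx.apply_mono, Ctx.apply_mono,
    smul_add, smul_add, smul_smul, h', show graft t 1 t = node t leaf leaf from rfl, hs, one_smul,
    add_assoc, add_sub_cancel_left]
  exact Submodule.add_mem _
    (Submodule.smul_mem _ _ (Submodule.smul_mem _ _ (mono_mem_supp h2)))
    (Submodule.smul_mem _ _ (Submodule.smul_mem _ _ (mono_mem_supp h3)))

theorem IsLM.sub_mem {f : TreePoly K} {q : TTree} (h : IsLM f q) :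
    f - f q • mono q ∈ supp K {p | Smaller p q} := by
  refine (Finsupp.mem_supported K _).2 fun p hp => ?_
  have hp := Finsupp.mem_support_iff.1 hp
  simp only [Finsupp.sub_apply, Finsupp.smul_apply, mono, smul_eq_mul] at hp
  by_cases hpq : p = q
  · subst hpq
    simp at hp
  · rw [Finsupp.single_eq_of_ne hpq, mul_zero, sub_zero] at hp
    obtain ⟨h1, h2⟩ := h.2 p (Finsupp.mem_support_iff.2 hp)
    exact ⟨h1, h2.resolve_left hpq⟩

/-- Well-founded induction on the leading monomial among the finitely many trees of arity `n`. It is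
always reducible because the element stays in the ideal, so the process can stop only at 0. -/
theorem reducesTo_zero {d : ℤ} (hd : Odd d) {n : ℕ} {f : TreePoly K}
    (hf : f ∈ idealSpan d {(alpha d : TreePoly K)}) (hn : IsHomog n f) :
    ReducesTo d {(alpha d : TreePoly K)} f 0 := by
  by_cases h0 : f = 0
  · rw [h0]; exact Relation.ReflTransGen.refl
  obtain ⟨q, hq⟩ := exists_isLM h0 hn
  have : IsStrictOrder TTree Smaller :=
    { irrefl := fun p h => lt_irrefl _ h.2, trans := fun _ _ _ h h' => h.trans h' }
  have hwf := (finite_arity_eq n).wellFoundedOn (r := Smaller)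
  have hqn : q ∈ {p | arity p = n} := hn q hq.1
  clear h0
  refine hwf.induction (P := fun q => ∀ f : TreePoly K, f ∈ idealSpan d {alpha d} → IsHomog n f →
    IsLM f q → ReducesTo d {alpha d} f 0) hqn (fun q hqn ih f hf hn hq => ?_) f hf hn hq
  obtain ⟨C, hC, hCq, h2, h3⟩ := exists_ctx_of_not_leftLeaf
    (not_leftLeaf_of_isLM (idealSpan_le_relSpan hd hf) hq)
  obtain ⟨hM, hMn⟩ := M_alpha_mem (K := K) (d := d) hC
  rw [hCq, hqn] at hMn
  set g := f - f q • M d C (graft t 1 t) (alpha d : TreePoly K) with hg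
  have hstep : ReducesStep d {(alpha d : TreePoly K)} f g :=
    ⟨_, rfl, q, _, C, hq, (isLM_alpha d).1, hC, hCq, by rw [(isLM_alpha d).2, div_one]⟩
  refine Relation.ReflTransGen.head hstep ?_
  by_cases h0 : g = 0
  · rw [h0]
  have hgn : IsHomog n g := isHomog_iff.2
    (Submodule.sub_mem _ (isHomog_iff.1 hn) (Submodule.smul_mem _ _ (isHomog_iff.1 hMn)))
  obtain ⟨p, hp⟩ := exists_isLM h0 hgn
  have hgs : g ∈ supp K {p | Smaller p q} := by
    have : g = (f - f q • mono q) -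
        f q • (M d C (graft t 1 t) (alpha d : TreePoly K) - mono q) := by
      rw [hg, smul_sub, sub_sub_sub_cancel_right]
    rw [this]
    exact Submodule.sub_mem _ hq.sub_mem (Submodule.smul_mem _ _ (M_alpha_sub_mem hd hCq h2 h3))
  exact ih p (hgn p hp.1) ((Finsupp.mem_supported K _).1 hgs hp.1) g
    (Submodule.sub_mem _ hf (Submodule.smul_mem _ _ hM)) hgn hp

/-! ### Small common multiples of `t ∘₁ t` with itself -/

theorem sPoly_alpha_reducesTo_zero {d : ℤ} (hd : Odd d) {p : TTree} {C D : Ctx}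
    (h : IsSCM (graft t 1 t) (graft t 1 t) p C D) :
    ReducesTo d {(alpha d : TreePoly K)}
      (sPoly d (graft t 1 t) (graft t 1 t) C D (alpha d) (alpha d)) 0 := by
  obtain ⟨h1, h2⟩ := M_alpha_mem (K := K) (d := d) h.valid_left
  obtain ⟨h3, h4⟩ := M_alpha_mem (K := K) (d := d) h.valid_right
  rw [h.plug_left] at h2
  rw [h.plug_right] at h4
  exact reducesTo_zero hd (Submodule.sub_mem _ h1 h3)
    (isHomog_iff.2 (Submodule.sub_mem _ (isHomog_iff.1 h2) (isHomog_iff.1 h4)))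

theorem nodes_t_graft_t : nodes (graft t 1 t) = {[], [0]} := by
  simp [t, graft, nodes, arity, Set.pair_comm]

theorem occNodes_t_graft_t (C : Ctx) : C.occNodes (graft t 1 t) = {C.pos, C.pos ++ [0]} := by
  rw [Ctx.occNodes, nodes_t_graft_t, Set.image_pair, List.append_nil]

theorem nil_mem_nodes {p : TTree} (h : p ≠ leaf) : [] ∈ nodes p := by
  cases p with
  | leaf => exact absurd rfl h
  | node a b c => simp [nodes]

theorem eq_leaf_of_nil_notMem {p : TTree} (h : [] ∉ nodes p) : p = leaf :=
  by_contra fun h' => h (nil_mem_nodes h')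

/-- No address ends in 1 or 2, so the nodes form a chain of first children, and `[0, 0, 0]` is not
available for a fourth one. -/
theorem weight_le_three {p : TTree} (h : nodes p ⊆ {[], [0], [0, 0]}) : weight p ≤ 3 := by
  have key : ∀ (a b c : TTree) (s : Set (List (Fin 3))), nodes (node a b c) ⊆ s →
      (∀ l, 1 :: l ∉ s) → (∀ l, 2 :: l ∉ s) → b = leaf ∧ c = leaf := by
    intro a b c s hs h1 h2
    refine ⟨eq_leaf_of_nil_notMem fun hb => h1 [] (hs ?_),
      eq_leaf_of_nil_notMem fun hc => h2 [] (hs ?_)⟩ <;> simp [nodes, *]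
  have sub : ∀ (a b c : TTree) (s : Set (List (Fin 3))), nodes (node a b c) ⊆ s →
      nodes a ⊆ {l | 0 :: l ∈ s} := fun a b c s hs l hl => hs (by simp [nodes, hl])
  rcases p with _ | ⟨a, b, c⟩
  · simp [weight]
  obtain ⟨rfl, rfl⟩ := key a b c _ h (by simp) (by simp)
  have ha := sub _ _ _ _ h
  rcases a with _ | ⟨a, b, c⟩
  · simp [weight]
  obtain ⟨rfl, rfl⟩ := key a b c _ ha (by simp) (by simp)
  have ha' := sub _ _ _ _ ha
  rcases a with _ | ⟨a, b, c⟩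
  · simp [weight]
  obtain ⟨rfl, rfl⟩ := key a b c _ ha' (by simp) (by simp)
  obtain rfl : a = leaf := eq_leaf_of_nil_notMem fun h' => by
    simpa using sub _ _ _ _ ha' h'
  simp [weight]

theorem isSCM_overlap : IsSCM (graft t 1 t) (graft t 1 t) (graft (graft t 1 t) 1 t)
    (Ctx.after Ctx.hole 1 t) (Ctx.into t 1 Ctx.hole) where
  valid_left := by simp [Ctx.Valid, Ctx.plug, t, graft, arity]
  plug_left := rfl
  valid_right := by simp [Ctx.Valid, t, arity]
  plug_right := rfl
  cover := by
    rw [occNodes_t_graft_t, occNodes_t_graft_t]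
    simp [t, graft, nodes, arity, Ctx.pos, leafAddr, Set.insert_subset_iff]
  small := by simp [t, graft, arity]

theorem M_after_t (d : ℤ) {C : Ctx} (h : (C.sign d (graft t 1 t) : K) = koszul d (graft t 1 t) 1 t)
    (h' : ∀ f : TreePoly K, C.apply d f = comp d f 1 (mono t)) :
    M d C (graft t 1 t) (alpha d : TreePoly K) = comp d (alpha d) 1 (mono t) := by
  rw [M, h, h', koszul_eq_one (by simp [t, graft, nodesAfter, arity, weight]), one_smul]

theorem M_into_t (d : ℤ) {C : Ctx} (h : (C.sign d (graft t 1 t) : K) = koszul d t 1 (graft t 1 t))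
    (h' : ∀ f : TreePoly K, C.apply d f = comp d (mono t) 1 f) :
    M d C (graft t 1 t) (alpha d : TreePoly K) = comp d (mono t) 1 (alpha d) := by
  rw [M, h, h', koszul_eq_one (by simp [t, nodesAfter, weight]), one_smul]

theorem sPoly_overlap (d : ℤ) :
    sPoly d (graft t 1 t) (graft t 1 t) (Ctx.after Ctx.hole 1 t) (Ctx.into t 1 Ctx.hole)
        (alpha d : TreePoly K) (alpha d) =
      comp d (alpha d) 1 (mono t) - comp d (mono t) 1 (alpha d) := by
  rw [sPoly, M_after_t d (by simp [Ctx.sign, Ctx.plug]) (fun f => rfl),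
    M_into_t d (by simp [Ctx.sign, Ctx.plug]) (fun f => rfl)]

/-- The root of `p` must be covered and can only be the root of the copy given by `C`, so the nodes
lie in `{[], [0], [0, 0]}`. With only two nodes, `D` would be trivial and its copy would sit at the
root; hence there are three, and each context adds a single `t`, whose place is read off from the
addresses and from `p`. -/
theorem IsSCM.eq_of_pos_eq (d : ℤ) {p : TTree} {C D : Ctx}
    (h : IsSCM (graft t 1 t) (graft t 1 t) p C D) (hpos : D.pos = C.pos ++ [0]) :
    p = graft (graft t 1 t) 1 t ∧
      M d C (graft t 1 t) (alpha d : TreePoly K) = comp d (alpha d) 1 (mono t) ∧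
      M d D (graft t 1 t) (alpha d : TreePoly K) = comp d (mono t) 1 (alpha d) := by
  have hw : weight (graft t 1 t) = 2 := by simp [t, graft, weight, arity]
  have hw2 := C.weight_le_plug (graft t 1 t)
  rw [h.plug_left, hw] at hw2
  have hcover := h.cover
  rw [occNodes_t_graft_t, occNodes_t_graft_t, hpos] at hcover
  have hC : C.pos = [] := by
    have := hcover (nil_mem_nodes fun h' => by simp [h', weight] at hw2)
    rcases this with (h' | h') | (h' | h')
    · exact h'.symm
    all_goals exact absurd h'.symm (List.append_ne_nil_of_right_ne_nil _ (List.cons_ne_nil _ _))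
  rw [hC, List.nil_append] at hpos
  have hw3 : weight p ≤ 3 := by
    refine weight_le_three (hcover.trans ?_)
    simp [hC, Set.insert_subset_iff]
  have hp3 : weight p = 3 := by
    by_contra hne
    have := (Ctx.eq_hole_of_weight K d (C := D) (p := graft t 1 t)
      (by rw [h.plug_right]; omega)).1
    simp [this] at hpos
  have har : arity (graft t 1 t) = 5 := by simp [t, graft, arity]
  have key : ∀ i, 1 ≤ i → i ≤ arity t → leafAddr t i = [0] → i = 1 := by
    intro i h1 h2 h3
    simp only [t, arity] at h2
    interval_cases i <;> simp [t, leafAddr, arity] at h3 ⊢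
  obtain ⟨-, -, -, h', -⟩ | ⟨i, hi, hi', hDpos, hDplug, hDsign, hDapply⟩ :=
    Ctx.eq_of_weight_add_one K d h.valid_right (by rw [h.plug_right]; omega)
  · simp [h'] at hpos
  obtain rfl := key i hi hi' (hDpos.symm.trans hpos)
  have hp : p = graft (graft t 1 t) 1 t := h.plug_right.symm.trans hDplug
  refine ⟨hp, ?_, M_into_t d hDsign hDapply⟩
  obtain ⟨j, hj, hj', -, hCplug, hCsign, hCapply⟩ | ⟨j, hj, hj', hCpos, -⟩ :=
    Ctx.eq_of_weight_add_one K d h.valid_left (by rw [h.plug_left]; omega)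
  -- Grafting `t` at any other leaf of `t ∘₁ t` gives a tree different from `p`.
  · have : j = 1 := by
      rw [h.plug_left, hp] at hCplug
      rw [har] at hj'
      interval_cases j <;> simp [t, graft, arity] at hCplug ⊢
    subst this
    exact M_after_t d hCsign hCapply
  · rw [hC] at hCpos
    simp only [t, leafAddr] at hCpos
    split_ifs at hCpos

theorem IsSCM.symm {q r p : TTree} {C D : Ctx} (h : IsSCM q r p C D) : IsSCM r q p D C where
  valid_left := h.valid_right
  plug_left := h.plug_right
  valid_right := h.valid_left
  plug_right := h.plug_left
  cover := by rw [Set.union_comm]; exact h.cover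
  small := by rw [add_comm]; exact h.small

/-- The copies occupy `{u, u ++ [0]}` and `{v, v ++ [0]}` with `u ≠ v`. A shared node forces `v = u
++ [0]` or `u = v ++ [0]`; the two cases differ by exchanging the copies, hence by a sign. -/
theorem IsSCM.overlap_unique (d : ℤ) {p : TTree} {C D : Ctx}
    (h : IsSCM (graft t 1 t) (graft t 1 t) p C D) (hne : C.pos ≠ D.pos)
    (hover : (C.occNodes (graft t 1 t) ∩ D.occNodes (graft t 1 t)).Nonempty) :
    p = graft (graft t 1 t) 1 t ∧
      (sPoly d (graft t 1 t) (graft t 1 t) C D (alpha d : TreePoly K) (alpha d) =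
          comp d (alpha d) 1 (mono t) - comp d (mono t) 1 (alpha d) ∨
        sPoly d (graft t 1 t) (graft t 1 t) C D (alpha d : TreePoly K) (alpha d) =
          -(comp d (alpha d) 1 (mono t) - comp d (mono t) 1 (alpha d))) := by
  obtain ⟨u, hu, hu'⟩ := hover
  rw [occNodes_t_graft_t] at hu hu'
  rcases hu with rfl | rfl <;> rcases hu' with hu' | hu'
  · exact absurd hu' hne
  · obtain ⟨h1, h2, h3⟩ := h.symm.eq_of_pos_eq (K := K) d hu'
    exact ⟨h1, Or.inr (by rw [sPoly, h2, h3, neg_sub])⟩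
  · obtain ⟨h1, h2, h3⟩ := h.eq_of_pos_eq (K := K) d hu'.symm
    exact ⟨h1, Or.inl (by rw [sPoly, h2, h3])⟩
  · exact absurd (List.append_cancel_right hu') hne

end

end TernaryOperad

theorem theorem3p11 (K : Type*) [Field K] [CharZero K] (d : ℤ) (hd : Odd d) :
    -- the partial composition rules with Koszul signs
    (∀ (p q r : TTree) (i j : ℕ), 1 ≤ i → i ≤ arity p →
      (i ≤ j → j ≤ i + arity q - 1 →
        comp d (comp d (mono p : TreePoly K) i (mono q)) j (mono r) =
          comp d (mono p) i (comp d (mono q) (j - i + 1) (mono r))) ∧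
      (i + arity q ≤ j → j ≤ arity p + arity q - 1 →
        comp d (comp d (mono p : TreePoly K) i (mono q)) j (mono r) =
          (-1 : K) ^ (weight q * weight r) •
            comp d (comp d (mono p) (j - arity q + 1) (mono r)) i (mono q)) ∧
      (1 ≤ j → j ≤ i - 1 →
        comp d (comp d (mono p : TreePoly K) i (mono q)) j (mono r) =
          (-1 : K) ^ (weight q * weight r) •
            comp d (comp d (mono p) j (mono r)) (i + arity r - 1) (mono q))) ∧
    -- `α` is a Gröbner basis for the ideal it generates
    IsGroebnerBasis d {(alpha d : TreePoly K)} (idealSpan d {alpha d}) ∧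
    -- `α` is monic with leading monomial `t ∘₁ t`
    IsLM (alpha d : TreePoly K) (graft t 1 t) ∧ (alpha d : TreePoly K) (graft t 1 t) = 1 ∧
    -- the overlap `(t ∘₁ t) ∘₁ t = t ∘₁ (t ∘₁ t)` of `t ∘₁ t` with itself is an SCM
    IsSCM (graft t 1 t) (graft t 1 t) (graft (graft t 1 t) 1 t)
      (Ctx.after Ctx.hole 1 t) (Ctx.into t 1 Ctx.hole) ∧
    sPoly d (graft t 1 t) (graft t 1 t) (Ctx.after Ctx.hole 1 t) (Ctx.into t 1 Ctx.hole)
        (alpha d : TreePoly K) (alpha d) =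
      comp d (alpha d) 1 (mono t) - comp d (mono t) 1 (alpha d) ∧
    -- every SCM in which two different copies of `t ∘₁ t` overlap is this one
    (∀ (p : TTree) (C D : Ctx), IsSCM (graft t 1 t) (graft t 1 t) p C D → C.pos ≠ D.pos →
      (C.occNodes (graft t 1 t) ∩ D.occNodes (graft t 1 t)).Nonempty →
      p = graft (graft t 1 t) 1 t ∧
      (sPoly d (graft t 1 t) (graft t 1 t) C D (alpha d : TreePoly K) (alpha d) =
          comp d (alpha d) 1 (mono t) - comp d (mono t) 1 (alpha d) ∨
        sPoly d (graft t 1 t) (graft t 1 t) C D (alpha d : TreePoly K) (alpha d) =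
          -(comp d (alpha d) 1 (mono t) - comp d (mono t) 1 (alpha d)))) ∧
    -- its S-polynomial, and that of every other SCM of `t ∘₁ t` with itself, reduces to zero
    ReducesTo d {(alpha d : TreePoly K)}
      (comp d (alpha d) 1 (mono t) - comp d (mono t) 1 (alpha d)) 0 ∧
    (∀ (p : TTree) (C D : Ctx), IsSCM (graft t 1 t) (graft t 1 t) p C D →
      ReducesTo d {(alpha d : TreePoly K)}
        (sPoly d (graft t 1 t) (graft t 1 t) C D (alpha d) (alpha d)) 0) := by
  refine ⟨fun p q r i j hi hip => ⟨comp_comp_of_mem hd p q r i j hi hip,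
      comp_comp_of_lt hd p q r i j hi, comp_comp_of_gt hd p q r i j hip⟩,
    isGroebnerBasis_alpha hd, (isLM_alpha d).1, (isLM_alpha d).2, isSCM_overlap, sPoly_overlap d,
    fun p C D h hne hover => h.overlap_unique d hne hover, ?_,
    fun p C D h => sPoly_alpha_reducesTo_zero hd h⟩
  rw [← sPoly_overlap]
  exact sPoly_alpha_reducesTo_zero hd isSCM_overlap
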